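/- A quantum circuit is a finite sequence of elementary gates acting on qubits, where the elementary gates are arbitrary one-qubit unitary gates, CNOT gates, and unbounded fan-out gates $|y\rangle|x_0\rangle\cdots|x_{k-1}\rangle\mapsto|y\rangle|x_0\oplus y\rangle\cdots|x_{k-1}\oplus y\rangle$ ($k\ge 1$). Its size is the sum over its gates of the number of qubits affected by the gate. Its depth is the maximal depth of a gate, where input qubits have depth $0$ and the depth of a gate is $1$ plus the maximal depth of the gates on which it depends (the earlier gates that share a qubit with it). For $1\le t\le n$ and $x\in\{0,1\}^n$ let $\mathrm{TH}_n^t(x)=1$ if the Hamming weight of $x$ is at least $t$, and $\mathrm{TH}_n^t(x)=0$ otherwise. A circuit on $n$ input qubits, one output qubit and any number of ancillary qubits initialized to $|0\rangle$ computes $\mathrm{TH}_n^t$ exactly if it maps $|x\rangle|z\rangle|0\cdots0\rangle$ to $|x\rangle|z\oplus\mathrm{TH}_n^t(x)\rangle|0\cdots0\rangle$ for all $x\in\{0,1\}^n$ and $z\in\{0,1\}$. Corollary. There are quantum circuits $C_n$ ($n\ge 1$), of depth $O(1)$ and size $O(n\sqrt{n\log n})$ as $n\to\infty$, such that $C_n$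 computes $\mathrm{TH}_n^{\lceil n/2\rceil}$ exactly for every $n\ge 1$. -/

import Mathlib

open scoped Matrix

namespace ExactQC

/-- Computational basis states of a set `ι` of qubits: assignments of bits.
Bits are elements of `Fin 2`, so that `+` is addition modulo 2. -/
abbrev Bits (ι : Type) : Type := ι → Fin 2

/-- The basis vector `|x⟩` of the state space `ℂ^({0,1}^ι)`. -/
noncomputable def ket {ι : Type} [Fintype ι] [DecidableEq ι] (x : Bits ι) : Bits ι → ℂ :=
  Pi.single x 1

/-- Elementary gates on the qubits `ι`: an arbitrary one-qubit unitary gate, and the unbounded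
fan-out gate with a control qubit `c` and a nonempty set `T` of target qubits.
The fan-out gate with exactly one target qubit is the CNOT gate. -/
inductive Gate (ι : Type) : Type where
  | single (q : ι) (U : Matrix.unitaryGroup (Fin 2) ℂ) : Gate ι
  | fanout (c : ι) (T : Finset ι) (hc : c ∉ T) (hT : T.Nonempty) : Gate ι

namespace Gate

/-- The set of qubits affected by a gate. -/
def support {ι : Type} [DecidableEq ι] : Gate ι → Finset ι
  | single q _ => {q}
  | fanout c T _ _ => insert c T

/-- The size of a gate: the number of qubits affected by it. -/
def size {ι : Type} [DecidableEq ι] (g : Gate ι) : ℕ := g.support.card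

/-- The unitary operation of a gate, as a matrix in the computational basis
(the column with index `y` is the image of `|y⟩`). A one-qubit gate acts as `U` on its qubit and
as the identity on the others; a fan-out gate adds the control bit modulo 2 to every target bit. -/
def toMatrix {ι : Type} [Fintype ι] [DecidableEq ι] :
    Gate ι → Matrix (Bits ι) (Bits ι) ℂ
  | single q U => Matrix.of fun x y =>
      if ∀ j, j ≠ q → x j = y j then (U : Matrix (Fin 2) (Fin 2) ℂ) (x q) (y q) else 0
  | fanout c T _ _ => Matrix.of fun x y =>
      if x = fun j => if j ∈ T then y j + y c else y j then 1 else 0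

end Gate

/-- A quantum circuit on the qubits `ι`: a list of elementary gates, in the order in which they
are applied. -/
abbrev Circuit (ι : Type) : Type := List (Gate ι)

namespace Circuit

/-- The unitary operation of a circuit; the head of the list is applied first. -/
def toMatrix {ι : Type} [Fintype ι] [DecidableEq ι] :
    Circuit ι → Matrix (Bits ι) (Bits ι) ℂ
  | [] => 1
  | g :: C => toMatrix C * g.toMatrix

/-- The size of a circuit: the total size of its gates. -/
def size {ι : Type} [DecidableEq ι] (C : Circuit ι) : ℕ := (C.map Gate.size).sum

/-- `depthFrom C d q` is the depth of qubit `q` after the circuit `C`, if qubit `j` has depth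
`d j` before it: the depth of a gate is 1 plus the maximal depth of the qubits on which it acts,
and all these qubits then have that depth. -/
def depthFrom {ι : Type} [DecidableEq ι] : Circuit ι → (ι → ℕ) → (ι → ℕ)
  | [], d => d
  | g :: C, d => depthFrom C fun q => if q ∈ g.support then 1 + g.support.sup d else d q

/-- The depth of a circuit: the maximal depth of its gates, where input qubits have depth 0. -/
def depth {ι : Type} [Fintype ι] [DecidableEq ι] (C : Circuit ι) : ℕ :=
  Finset.univ.sup (depthFrom C fun _ => 0)

end Circuit

/-- The qubits of a circuit for a Boolean function of `n` bits: `n` input qubits, one output qubit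
and `a` ancillary qubits. -/
abbrev Register (n a : ℕ) : Type := Fin n ⊕ Fin 1 ⊕ Fin a

/-- The basis state `|x⟩|z⟩|0…0⟩` of a register. -/
def Register.bits {n : ℕ} (a : ℕ) (x : Fin n → Fin 2) (z : Fin 2) : Bits (Register n a) :=
  Sum.elim x (Sum.elim (fun _ => z) (fun _ => 0))

/-- The circuit implements exactly the quantum operation `|x⟩|z⟩ ↦ |x⟩|z ⊕ f(x)⟩`, where the
ancillary qubits start in `|0⟩` and are returned to `|0⟩`. -/
def Computes {n a : ℕ} (C : Circuit (Register n a)) (f : (Fin n → Fin 2) → Fin 2) : Prop :=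
  ∀ (x : Fin n → Fin 2) (z : Fin 2),
    C.toMatrix *ᵥ ket (Register.bits a x z) = ket (Register.bits a x (z + f x))

/-- The threshold function with threshold `t` on `n` bits: 1 if the Hamming weight of the input is
at least `t`, and 0 otherwise. -/
def threshold (n t : ℕ) (x : Fin n → Fin 2) : Fin 2 :=
  if t ≤ ∑ j, (x j : ℕ) then 1 else 0

end ExactQC

set_option linter.unusedSectionVars false

/-! Put `M = 2 ^ m` with `m` minimal such that `n ≤ M ^ 3`, and let `s = M ^ 3 - t + |x|`. Since `1
≤ t` and `t, n ≤ M ^ 3`, the quotient `s / M ^ 3` is 0 or 1, and it is the threshold bit. The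
circuit finds the three lower base-`M` digits of `s`, each stored one-hot in `M` qubits, adds the
quotient to the output, and then erases the digits. Once the digits below `r` are known, `s / M ^ r`
is an affine function of the input bits and the digit qubits (`shifted_digitState`), so all steps
have the same shape.

Whether an integer-valued affine function is congruent to `v` modulo `2 ^ m` is decided without
error. For each `k < m` a work qubit is rotated by an angle depending linearly on the value. If the
congruence holds, all `m` qubits become exactly 1; if not, at least one of them is exactly 0, while
the others may be in superposition. In every branch the AND of the work qubits is therefore the
right answer; it is added to the result qubit, and the rotations are undone (`select_mulVec_ket`).

Rotations with state-dependent angles are diagonal phase operators between Hadamards. A phase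
polynomial is a linear combination of monomials, hence of parities (`monomial_eq_sum_parity`). Many
parities are computed in constant depth, because a fan-out gate between Hadamards adds its targets
to its control (`hadamards_conj_fansMap`), and fan-out supplies each parity with private copies of
its bits. Phase gates on the parity qubits and uncomputation finish the job (`realizes_phases`).

A digit needs `M * m` test rotations of cost `O(n)` and `M` ANDs of cost `O(M * m)`. With `M` of
order `n ^ (1/3)` the size is `O(n ^ (4/3) * log n)`, which lies below the required bound. -/

namespace ExactQC

/-! ### Matrices of layers of gates, and the parity gate obtained from fan-out. -/

section Operators

variable {ι : Type} [Fintype ι] [DecidableEq ι]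

/-- The tensor product of one-qubit operators. -/
def tensor (M : ι → Matrix (Fin 2) (Fin 2) ℂ) : Matrix (Bits ι) (Bits ι) ℂ :=
  Matrix.of fun x y => ∏ q, M q (x q) (y q)

/-- The operator that maps the basis state `y` to the basis state `f y`. -/
def basisMap (f : Bits ι → Bits ι) : Matrix (Bits ι) (Bits ι) ℂ :=
  Matrix.of fun x y => if x = f y then 1 else 0

lemma tensor_mul (M N : ι → Matrix (Fin 2) (Fin 2) ℂ) :
    tensor M * tensor N = tensor fun q => M q * N q := by
  ext x y
  simp only [tensor, Matrix.mul_apply, Matrix.of_apply, Finset.prod_univ_sum,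
    ← Finset.prod_mul_distrib, Fintype.piFinset_univ]

lemma tensor_diagonal (d : ι → Fin 2 → ℂ) :
    tensor (fun q => Matrix.diagonal (d q)) = Matrix.diagonal fun x => ∏ q, d q (x q) := by
  ext x y
  simp only [tensor, Matrix.of_apply]
  by_cases h : x = y
  · subst h; simp
  · rw [Matrix.diagonal_apply_ne _ h]
    obtain ⟨q, hq⟩ := Function.ne_iff.1 h
    exact Finset.prod_eq_zero (Finset.mem_univ q) (Matrix.diagonal_apply_ne _ hq)

lemma tensor_one : tensor (fun _ : ι => (1 : Matrix (Fin 2) (Fin 2) ℂ)) = 1 := by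
  have := tensor_diagonal (fun (_ : ι) (_ : Fin 2) => (1 : ℂ))
  simpa using this

lemma basisMap_mul (f g : Bits ι → Bits ι) : basisMap f * basisMap g = basisMap (f ∘ g) := by
  ext x y
  simp [basisMap, Matrix.mul_apply]

lemma basisMap_id : basisMap (id : Bits ι → Bits ι) = 1 := by
  ext x y
  simp [basisMap, Matrix.one_apply]

lemma mul_basisMap_apply (A : Matrix (Bits ι) (Bits ι) ℂ) (f : Bits ι → Bits ι) (x y : Bits ι) :
    (A * basisMap f) x y = A x (f y) := by
  simp [basisMap, Matrix.mul_apply]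

lemma basisMap_mul_apply (A : Matrix (Bits ι) (Bits ι) ℂ) {f : Bits ι → Bits ι}
    (hf : Function.Involutive f) (x y : Bits ι) :
    (basisMap f * A) x y = A (f x) y := by
  have : ∀ z, (x = f z) = (z = f x) := fun z =>
    propext ⟨fun h => by rw [h, hf z], fun h => by rw [h, hf x]⟩
  simp [basisMap, Matrix.mul_apply, this]

/-- Compute, apply a phase, uncompute: since `f` and `g` are involutions, the second half undoes the
first and only the phase at the computed state survives. -/
lemma basisMap_conj_diagonal {f g : Bits ι → Bits ι} (hf : Function.Involutive f)
    (hg : Function.Involutive g) (d : Bits ι → ℂ) :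
    basisMap f * (basisMap g * (Matrix.diagonal d * (basisMap g * basisMap f))) =
      Matrix.diagonal fun x => d (g (f x)) := by
  ext x y
  rw [basisMap_mul_apply _ hf, basisMap_mul_apply _ hg, basisMap_mul, Matrix.diagonal_mul]
  by_cases h : x = y
  · subst h; simp [basisMap]
  · have : ¬ g (f x) = g (f y) := fun h' => h (hf.injective (hg.injective h'))
    simp [basisMap, h, this]

lemma Circuit.toMatrix_append (C D : Circuit ι) :
    Circuit.toMatrix (C ++ D) = Circuit.toMatrix D * Circuit.toMatrix C := by
  induction C with
  | nil => simp [Circuit.toMatrix]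
  | cons g C ih => simp [Circuit.toMatrix, ih, Matrix.mul_assoc]

lemma Gate.toMatrix_single (q : ι) (U : Matrix.unitaryGroup (Fin 2) ℂ) :
    (Gate.single q U).toMatrix = tensor fun j => if j = q then U.1 else 1 := by
  ext x y
  simp only [Gate.toMatrix, tensor, Matrix.of_apply]
  split_ifs with h
  · rw [Finset.prod_eq_single q]
    · simp
    · intro j _ hj
      rw [if_neg hj, h j hj, Matrix.one_apply_eq]
    · simp
  · push Not at h
    obtain ⟨j, hj, hne⟩ := h
    symm
    apply Finset.prod_eq_zero (Finset.mem_univ j)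
    simp [hj, hne]

/-- The layer that applies the one-qubit gate `U q` to every qubit `q` of `A`. -/
noncomputable def singles (A : Finset ι) (U : ι → Matrix.unitaryGroup (Fin 2) ℂ) : Circuit ι :=
  A.toList.map fun q => Gate.single q (U q)

lemma toMatrix_singles (A : Finset ι) (U : ι → Matrix.unitaryGroup (Fin 2) ℂ) :
    Circuit.toMatrix (singles A U) = tensor fun q => if q ∈ A then (U q).1 else 1 := by
  have key : ∀ l : List ι, l.Nodup →
      Circuit.toMatrix (l.map fun q => Gate.single q (U q)) =
        tensor fun q => if q ∈ l then (U q).1 else 1 := by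
    intro l
    induction l with
    | nil => simp [Circuit.toMatrix, tensor_one]
    | cons q l ih =>
      intro h
      rw [List.nodup_cons] at h
      rw [List.map_cons, Circuit.toMatrix, ih h.2, Gate.toMatrix_single, tensor_mul]
      congr 1
      funext j
      by_cases hj : j = q
      · subst hj; simp [h.1]
      · simp [hj]
  simpa [singles] using key A.toList A.nodup_toList

/-- The fan-out gate with control `c` and targets `T` (no gate if there is nothing to do). -/
def fan (c : ι) (T : Finset ι) : Circuit ι :=
  if h : c ∉ T ∧ T.Nonempty then [Gate.fanout c T h.1 h.2] else []

lemma toMatrix_fan {c : ι} {T : Finset ι} (hc : c ∉ T) :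
    Circuit.toMatrix (fan c T) = basisMap fun y j => y j + if j ∈ T then y c else 0 := by
  unfold fan
  split_ifs with h
  · ext x y
    simp only [Circuit.toMatrix, Gate.toMatrix, basisMap, Matrix.one_mul, Matrix.of_apply]
    congr 2
    funext j
    split_ifs <;> simp
  · have : T = ∅ := by simpa [hc] using h
    subst this
    simp only [Circuit.toMatrix, Finset.notMem_empty, if_false, add_zero]
    exact basisMap_id.symm

variable {κ : Type}

/-- The layer of the fan-out gates with control `c i` and targets `T i`, for `i` in `s`. -/
noncomputable def fans (s : Finset κ) (c : κ → ι) (T : κ → Finset ι) : Circuit ι :=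
  s.toList.flatMap fun i => fan (c i) (T i)

/-- The action of a layer of fan-out gates on basis states. -/
def fansMap (s : Finset κ) (c : κ → ι) (T : κ → Finset ι) (y : Bits ι) : Bits ι :=
  fun j => y j + ∑ i ∈ s, if j ∈ T i then y (c i) else 0

/-- The transpose of `fansMap`, in which targets and controls are exchanged. -/
def parityMap (s : Finset κ) (c : κ → ι) (T : κ → Finset ι) (y : Bits ι) : Bits ι :=
  fun j => y j + ∑ i ∈ s, if j = c i then ∑ t ∈ T i, y t else 0

/-- No control is a target, so every gate reads the original control bit and the order of the gates
is irrelevant. -/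
lemma toMatrix_fans (s : Finset κ) {c : κ → ι} {T : κ → Finset ι}
    (h : ∀ i ∈ s, ∀ j ∈ s, c i ∉ T j) :
    Circuit.toMatrix (fans s c T) = basisMap (fansMap s c T) := by
  have key : ∀ l : List κ, (∀ i ∈ l, ∀ j ∈ l, c i ∉ T j) →
      Circuit.toMatrix (l.flatMap fun i => fan (c i) (T i)) =
        basisMap fun y j => y j + (l.map fun i => if j ∈ T i then y (c i) else 0).sum := by
    intro l
    induction l with
    | nil => intro _; simpa [Circuit.toMatrix, Function.id_def] using basisMap_id.symm
    | cons i l ih =>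
      intro h
      rw [List.flatMap_cons, Circuit.toMatrix_append,
        ih (fun a ha b hb => h a (by simp [ha]) b (by simp [hb])),
        toMatrix_fan (h i (by simp) i (by simp)), basisMap_mul]
      congr 1
      funext y j
      have : ∀ a ∈ l, y (c a) + (if c a ∈ T i then y (c i) else 0) = y (c a) := fun a ha => by
        simp [h a (by simp [ha]) i (by simp)]
      simp only [Function.comp, List.map_cons, List.sum_cons, ← add_assoc]
      congr 2
      apply List.map_congr_left
      intro a ha
      rw [this a ha]
  rw [fans, key _ (by simpa using h)]
  congr 1
  funext y j
  rw [Finset.sum_map_toList, fansMap]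

lemma fin_two_add_self (b : Fin 2) : b + b = 0 := by
  revert b; decide

lemma fansMap_involutive {s : Finset κ} {c : κ → ι} {T : κ → Finset ι}
    (h : ∀ i ∈ s, ∀ j ∈ s, c i ∉ T j) : Function.Involutive (fansMap s c T) := by
  intro y
  have hc : ∀ i ∈ s, fansMap s c T y (c i) = y (c i) := by
    intro i hi
    simp only [fansMap]
    rw [Finset.sum_eq_zero, add_zero]
    intro j hj
    rw [if_neg (h i hi j hj)]
  funext j
  rw [fansMap, Finset.sum_congr rfl (fun i hi => by rw [hc i hi]), fansMap, add_assoc,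
    fin_two_add_self, add_zero]

lemma parityMap_involutive {s : Finset κ} {c : κ → ι} {T : κ → Finset ι}
    (h : ∀ i ∈ s, ∀ j ∈ s, c i ∉ T j) : Function.Involutive (parityMap s c T) := by
  intro y
  have hc : ∀ i ∈ s, ∀ t ∈ T i, parityMap s c T y t = y t := by
    intro i hi t ht
    simp only [parityMap]
    rw [Finset.sum_eq_zero, add_zero]
    intro j hj
    rw [if_neg]
    rintro rfl
    exact h j hj i hi ht
  funext j
  rw [parityMap, Finset.sum_congr rfl (fun i hi => by rw [Finset.sum_congr rfl (hc i hi)]),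
    parityMap, add_assoc, fin_two_add_self, add_zero]

/-- The sign `(-1)^(a b)`. -/
def bitSign (a b : Fin 2) : ℂ := if a = 1 ∧ b = 1 then -1 else 1

lemma bitSign_add_left (a b c : Fin 2) : bitSign (a + b) c = bitSign a c * bitSign b c := by
  fin_cases a <;> fin_cases b <;> fin_cases c <;> simp [bitSign]

lemma bitSign_add_right (a b c : Fin 2) : bitSign a (b + c) = bitSign a b * bitSign a c := by
  fin_cases a <;> fin_cases b <;> fin_cases c <;> simp [bitSign]

lemma bitSign_sum_left (s : Finset κ) (f : κ → Fin 2) (b : Fin 2) :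
    bitSign (∑ i ∈ s, f i) b = ∏ i ∈ s, bitSign (f i) b := by
  classical
  induction s using Finset.induction_on with
  | empty => simp [bitSign]
  | insert i s hi ih => rw [Finset.sum_insert hi, Finset.prod_insert hi, bitSign_add_left, ih]

lemma bitSign_sum_right (s : Finset κ) (f : κ → Fin 2) (b : Fin 2) :
    bitSign b (∑ i ∈ s, f i) = ∏ i ∈ s, bitSign b (f i) := by
  classical
  induction s using Finset.induction_on with
  | empty => simp [bitSign]
  | insert i s hi ih => rw [Finset.sum_insert hi, Finset.prod_insert hi, bitSign_add_right, ih]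

/-- The Hadamard matrix. -/
noncomputable def hadamard : Matrix (Fin 2) (Fin 2) ℂ :=
  Matrix.of fun a b => ((√2 : ℝ) : ℂ)⁻¹ * bitSign a b

lemma hadamard_mul_self : hadamard * hadamard = 1 := by
  have h : (((√2 : ℝ) : ℂ)⁻¹) * ((√2 : ℝ) : ℂ)⁻¹ = 2⁻¹ := by
    rw [← mul_inv, ← Complex.ofReal_mul, Real.mul_self_sqrt (by norm_num)]
    norm_num
  ext a b
  simp only [hadamard, Matrix.mul_apply, Matrix.of_apply, Fin.sum_univ_two]
  have e : ∀ u v : ℂ, (((√2 : ℝ) : ℂ)⁻¹ * u) * (((√2 : ℝ) : ℂ)⁻¹ * v) = 2⁻¹ * (u * v) := by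
    intro u v; rw [← h]; ring
  rw [e, e]
  fin_cases a <;> fin_cases b <;> norm_num [bitSign]

/-- The Hadamard gate. -/
noncomputable def hadamardGate : Matrix.unitaryGroup (Fin 2) ℂ :=
  ⟨hadamard, by
    have : star hadamard = hadamard := by
      ext a b
      simp only [hadamard, Matrix.star_apply, Matrix.of_apply]
      fin_cases a <;> fin_cases b <;> simp [bitSign]
    rw [Matrix.mem_unitaryGroup_iff, this, hadamard_mul_self]⟩

/-- The one-qubit phase gate with phase `θ`, as a vector of diagonal entries. -/
noncomputable def phase (θ : ℝ) (b : Fin 2) : ℂ := Complex.exp (((θ * (b : ℕ) : ℝ) : ℂ) * Complex.I)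

/-- The one-qubit phase gate. -/
noncomputable def phaseGate (θ : ℝ) : Matrix.unitaryGroup (Fin 2) ℂ :=
  ⟨Matrix.diagonal (phase θ), by
    rw [Matrix.mem_unitaryGroup_iff, Matrix.star_eq_conjTranspose, Matrix.diagonal_conjTranspose,
      Matrix.diagonal_mul_diagonal, ← Matrix.diagonal_one]
    congr 1
    funext b
    rw [Pi.star_apply, phase, Complex.star_def, ← Complex.exp_conj, ← Complex.exp_add]
    simp⟩

/-- The Hadamard transform on the qubits of `A`. -/
noncomputable def hadamards (A : Finset ι) : Matrix (Bits ι) (Bits ι) ℂ :=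
  tensor fun q => if q ∈ A then hadamard else 1

lemma hadamards_mul_self (A : Finset ι) : hadamards A * hadamards A = 1 := by
  rw [hadamards, tensor_mul, ← tensor_one]
  congr 1
  funext q
  split_ifs
  · exact hadamard_mul_self
  · exact one_mul 1

lemma hadamards_apply (A : Finset ι) (x y : Bits ι) :
    hadamards A x y = (if ∀ q, q ∉ A → x q = y q then 1 else 0) *
      ((((√2 : ℝ) : ℂ)⁻¹) ^ A.card * ∏ q ∈ A, bitSign (x q) (y q)) := by
  simp only [hadamards, tensor, Matrix.of_apply]
  rw [← Finset.prod_const, ← Finset.prod_mul_distrib, ← Finset.prod_compl_mul_prod A]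
  congr 1
  · split_ifs with h
    · apply Finset.prod_eq_one
      intro q hq
      rw [Finset.mem_compl] at hq
      rw [if_neg hq, h q hq, Matrix.one_apply_eq]
    · push Not at h
      obtain ⟨q, hq, hne⟩ := h
      apply Finset.prod_eq_zero (Finset.mem_compl.2 hq)
      simp [hq, hne]
  · apply Finset.prod_congr rfl
    intro q hq
    simp [hq, hadamard]

/-- The Hadamard kernel is a multiple of `(-1) ^ (x · y)`, and the two maps are transposes over the
field with two elements: `x · fansMap y = parityMap x · y`. So the Hadamard transform intertwines
them. -/
lemma hadamards_conj_fansMap {A : Finset ι} {s : Finset κ} {c : κ → ι} {T : κ → Finset ι}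
    (h : ∀ i ∈ s, ∀ j ∈ s, c i ∉ T j) (hc : ∀ i ∈ s, c i ∈ A) (hT : ∀ i ∈ s, T i ⊆ A) :
    hadamards A * (basisMap (fansMap s c T) * hadamards A) = basisMap (parityMap s c T) := by
  have key : hadamards A * basisMap (fansMap s c T) =
      basisMap (parityMap s c T) * hadamards A := by
    ext x y
    rw [mul_basisMap_apply, basisMap_mul_apply _ (parityMap_involutive h), hadamards_apply,
      hadamards_apply]
    have h1 : ∀ q, q ∉ A → fansMap s c T y q = y q := by
      intro q hq
      simp only [fansMap]
      rw [Finset.sum_eq_zero, add_zero]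
      intro j hj
      rw [if_neg fun h' => hq (hT j hj h')]
    have h2 : ∀ q, q ∉ A → parityMap s c T x q = x q := by
      intro q hq
      simp only [parityMap]
      rw [Finset.sum_eq_zero, add_zero]
      intro j hj
      rw [if_neg fun h' => hq (by rw [h']; exact hc j hj)]
    congr 1
    · congr 1
      apply propext
      exact forall₂_congr fun q hq => by rw [h1 q hq, h2 q hq]
    · congr 1
      have e1 : ∀ q, bitSign (x q) (fansMap s c T y q) = bitSign (x q) (y q) *
          ∏ i ∈ s, if q ∈ T i then bitSign (x q) (y (c i)) else 1 := by
        intro q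
        rw [fansMap, bitSign_add_right, bitSign_sum_right]
        congr 1
        apply Finset.prod_congr rfl
        intro i _
        split_ifs <;> simp [bitSign]
      have e2 : ∀ q, bitSign (parityMap s c T x q) (y q) = bitSign (x q) (y q) *
          ∏ i ∈ s, if q = c i then ∏ t ∈ T i, bitSign (x t) (y q) else 1 := by
        intro q
        rw [parityMap, bitSign_add_left, bitSign_sum_left]
        congr 1
        apply Finset.prod_congr rfl
        intro i _
        split_ifs
        · rw [bitSign_sum_left]
        · simp [bitSign]
      simp only [e1, e2, Finset.prod_mul_distrib]
      congr 1
      rw [Finset.prod_comm, Finset.prod_comm (s := A)]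
      apply Finset.prod_congr rfl
      intro i hi
      rw [Finset.prod_ite_eq_of_mem' _ _ _ (hc i hi), Finset.prod_ite_mem,
        Finset.inter_eq_right.2 (hT i hi)]
  rw [← Matrix.mul_assoc, key, Matrix.mul_assoc, hadamards_mul_self, Matrix.mul_one]

end Operators

/-! ### Bounds for depth and size that are compatible with concatenation. -/

section DepthAndSize

variable {ι : Type} [DecidableEq ι]

/-- The circuit increases the depth of the qubits by at most `k`. -/
def DepthLE (C : Circuit ι) (k : ℕ) : Prop :=
  ∀ (d : ι → ℕ) (b : ℕ), (∀ q, d q ≤ b) → ∀ q, Circuit.depthFrom C d q ≤ b + k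

lemma Circuit.depthFrom_append (C D : Circuit ι) (d : ι → ℕ) :
    Circuit.depthFrom (C ++ D) d = Circuit.depthFrom D (Circuit.depthFrom C d) := by
  induction C generalizing d with
  | nil => rfl
  | cons g C ih => exact ih _

lemma DepthLE.append {C D : Circuit ι} {k l : ℕ} (hC : DepthLE C k) (hD : DepthLE D l) :
    DepthLE (C ++ D) (k + l) := by
  intro d b hd q
  rw [Circuit.depthFrom_append, ← add_assoc]
  exact hD _ _ (hC d b hd) q

lemma DepthLE.depth_le [Fintype ι] {C : Circuit ι} {k : ℕ} (h : DepthLE C k) : C.depth ≤ k :=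
  Finset.sup_le fun q _ => by simpa using h (fun _ => 0) 0 (fun _ => le_rfl) q

lemma depthLE_one_of_pairwise_disjoint {C : Circuit ι}
    (h : C.Pairwise fun g g' => Disjoint g.support g'.support) : DepthLE C 1 := by
  -- The induction needs two bounds: `b` on the qubits that remaining gates will touch, and `b + 1`
  -- on all qubits.
  have key : ∀ (C : Circuit ι) (d : ι → ℕ) (b : ℕ),
      C.Pairwise (fun g g' => Disjoint g.support g'.support) →
      (∀ g ∈ C, ∀ q ∈ g.support, d q ≤ b) → (∀ q, d q ≤ b + 1) →
      ∀ q, Circuit.depthFrom C d q ≤ b + 1 := by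
    intro C
    induction C with
    | nil => exact fun d b _ _ h => h
    | cons g C ih =>
      intro d b hC hb hb'
      rw [List.pairwise_cons] at hC
      refine ih _ b hC.2 ?_ ?_
      · intro g' hg' q hq
        have : q ∉ g.support := fun h' => Finset.disjoint_left.1 (hC.1 g' hg') h' hq
        simp only [this, if_false]
        exact hb g' (List.mem_cons_of_mem _ hg') q hq
      · intro q
        split_ifs
        · have : g.support.sup d ≤ b := Finset.sup_le (hb g List.mem_cons_self)
          omega
        · exact hb' q
  intro d b hd
  exact key C d b h (fun _ _ q _ => hd q) fun q => (hd q).trans (Nat.le_succ b)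

lemma depthLE_singles (A : Finset ι) (U : ι → Matrix.unitaryGroup (Fin 2) ℂ) :
    DepthLE (singles A U) 1 := by
  apply depthLE_one_of_pairwise_disjoint
  rw [singles, List.pairwise_map]
  refine A.nodup_toList.imp ?_
  intro a b hab
  simpa [Gate.support] using hab

lemma support_of_mem_fan {c : ι} {T : Finset ι} {g : Gate ι} (hg : g ∈ fan c T) :
    g.support = insert c T := by
  unfold fan at hg
  split_ifs at hg
  · simp only [List.mem_singleton] at hg
    subst hg
    rfl
  · simp at hg

lemma depthLE_fans {κ : Type} (s : Finset κ) {c : κ → ι} {T : κ → Finset ι}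
    (h : ∀ i ∈ s, ∀ j ∈ s, i ≠ j → Disjoint (insert (c i) (T i)) (insert (c j) (T j))) :
    DepthLE (fans s c T) 1 := by
  apply depthLE_one_of_pairwise_disjoint
  rw [fans, List.pairwise_flatMap]
  constructor
  · intro i _
    unfold fan
    split_ifs <;> simp
  · refine (List.Pairwise.and_mem.1 s.nodup_toList).imp ?_
    rintro i j ⟨hi, hj, hij⟩ g hg g' hg'
    rw [support_of_mem_fan hg, support_of_mem_fan hg']
    exact h i (by simpa using hi) j (by simpa using hj) hij

lemma Circuit.size_append (C D : Circuit ι) : Circuit.size (C ++ D) = C.size + D.size := by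
  simp [Circuit.size]

lemma size_singles (A : Finset ι) (U : ι → Matrix.unitaryGroup (Fin 2) ℂ) :
    Circuit.size (singles A U) = A.card := by
  simp [Circuit.size, singles, Function.comp_def, Gate.size, Gate.support]

lemma size_fan_le (c : ι) (T : Finset ι) :
    Circuit.size (fan c T) ≤ 2 * T.card := by
  unfold fan
  split_ifs with h
  · have := h.2.card_pos
    simp [Circuit.size, Gate.size, Gate.support, h.1]
    omega
  · simp [Circuit.size]

lemma size_fans_le {κ : Type} (s : Finset κ) (c : κ → ι) (T : κ → Finset ι) :
    Circuit.size (fans s c T) ≤ ∑ i ∈ s, 2 * (T i).card := by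
  have key : ∀ l : List κ, Circuit.size (l.flatMap fun i => fan (c i) (T i)) ≤
      (l.map fun i => 2 * (T i).card).sum := by
    intro l
    induction l with
    | nil => simp [Circuit.size]
    | cons i l ih =>
      rw [List.flatMap_cons, Circuit.size_append, List.map_cons, List.sum_cons]
      exact Nat.add_le_add (size_fan_le _ _) ih
  rw [← Finset.sum_map_toList]
  exact key _

end DepthAndSize

/-! ### Operators implemented with clean ancillary qubits. -/

section Realization

variable {L K : Type} [Fintype L] [DecidableEq L] [Fintype K] [DecidableEq K]

/-- The isometry that adds ancillary qubits in the state `|0⟩`. -/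
def addZeros (L K : Type) [Fintype L] [DecidableEq L] [Fintype K] [DecidableEq K] :
    Matrix (Bits (L ⊕ K)) (Bits L) ℂ :=
  Matrix.of fun w x => if w = Sum.elim x 0 then 1 else 0

/-- `T` is implemented, with clean ancillary qubits `K`, by a circuit of depth at most `k` and
size at most `s`. -/
def Realizes (K : Type) [Fintype K] [DecidableEq K] (T : Matrix (Bits L) (Bits L) ℂ)
    (k s : ℕ) : Prop :=
  ∃ C : Circuit (L ⊕ K), DepthLE C k ∧ C.size ≤ s ∧
    C.toMatrix * addZeros L K = addZeros L K * T

lemma Realizes.mul {S T : Matrix (Bits L) (Bits L) ℂ} {k l s t : ℕ}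
    (hS : Realizes K S k s) (hT : Realizes K T l t) : Realizes K (S * T) (l + k) (t + s) := by
  obtain ⟨C, hC, hCs, hCm⟩ := hS
  obtain ⟨D, hD, hDs, hDm⟩ := hT
  refine ⟨D ++ C, hD.append hC, ?_, ?_⟩
  · rw [Circuit.size_append]; omega
  · rw [Circuit.toMatrix_append, Matrix.mul_assoc, hDm, ← Matrix.mul_assoc, hCm, Matrix.mul_assoc]

lemma mul_addZeros_apply (A : Matrix (Bits (L ⊕ K)) (Bits (L ⊕ K)) ℂ) (w : Bits (L ⊕ K))
    (x : Bits L) : (A * addZeros L K) w x = A w (Sum.elim x 0) := by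
  simp [addZeros, Matrix.mul_apply]

lemma addZeros_mul_apply (T : Matrix (Bits L) (Bits L) ℂ) (u : Bits L) (v : Bits K) (x : Bits L) :
    (addZeros L K * T) (Sum.elim u v : Bits (L ⊕ K)) x = if v = 0 then T u x else 0 := by
  have : ∀ y : Bits L, ((Sum.elim u v : Bits (L ⊕ K)) = Sum.elim y 0) = (v = 0 ∧ u = y) := by
    intro y
    rw [Sum.elim_eq_iff, and_comm]
  simp only [addZeros, Matrix.mul_apply, Matrix.of_apply, this]
  split_ifs with h <;> simp [h]

lemma realizes_hadamards (A : Finset L) : Realizes K (hadamards A) 1 A.card := by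
  refine ⟨singles (A.map ⟨Sum.inl, Sum.inl_injective⟩) fun _ => hadamardGate,
    depthLE_singles _ _, by rw [size_singles, Finset.card_map], ?_⟩
  ext w x
  rw [← Sum.elim_comp_inl_inr w, mul_addZeros_apply, addZeros_mul_apply, toMatrix_singles,
    hadamards]
  simp only [tensor, Matrix.of_apply, Fintype.prod_sum_type, Sum.elim_inl, Sum.elim_inr]
  have h1 : ∀ k : K, (Sum.inr k : L ⊕ K) ∉ A.map ⟨Sum.inl, Sum.inl_injective⟩ := by simp
  have h2 : ∀ q : L, (Sum.inl q : L ⊕ K) ∈ A.map ⟨Sum.inl, Sum.inl_injective⟩ ↔ q ∈ A := by simp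
  simp only [h1, h2, if_false]
  split_ifs with h
  · rw [h]
    simp [hadamardGate]
  · obtain ⟨k, hk⟩ := Function.ne_iff.1 h
    rw [mul_eq_zero]
    right
    exact Finset.prod_eq_zero (Finset.mem_univ k) (Matrix.one_apply_ne hk)

end Realization

/-! ### Phases that are linear combinations of parities, in constant depth. -/

section ParityPhase

variable {L : Type} [Fintype L] [DecidableEq L]

/-- The ancillary qubits of a phase circuit: a copy of every qubit for every set of qubits, and a
qubit for the parity of every set of qubits. -/
abbrev ParityAncilla (L : Type) : Type := (Finset L × L) ⊕ Finset L

/-- The parity of the bits in `T`, as a real number. -/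
def parity (T : Finset L) (y : Bits L) : ℝ := (((∑ q ∈ T, y q : Fin 2) : ℕ) : ℝ)

/-- The diagonal operator with phases `φ`. -/
noncomputable def phases (φ : Bits L → ℝ) : Matrix (Bits L) (Bits L) ℂ :=
  Matrix.diagonal fun y => Complex.exp ((φ y : ℂ) * Complex.I)

namespace ParityPhase

/-- The copy of the qubit `q` for the set `T`. -/
def copy (T : Finset L) (q : L) : L ⊕ ParityAncilla L := Sum.inr (Sum.inl (T, q))

/-- The qubit that holds the parity of `T`. -/
def par (T : Finset L) : L ⊕ ParityAncilla L := Sum.inr (Sum.inr T)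

/-- The copies for the set `T`. -/
def copies (T : Finset L) : Finset (L ⊕ ParityAncilla L) := T.image (copy T)

/-- The copies of the qubit `q`. -/
def copiesOf (𝒯 : Finset (Finset L)) (q : L) : Finset (L ⊕ ParityAncilla L) :=
  {T ∈ 𝒯 | q ∈ T}.image fun T => copy T q

/-- The ancillary qubits that are used for the family `𝒯`. -/
def work (𝒯 : Finset (Finset L)) : Finset (L ⊕ ParityAncilla L) :=
  𝒯.biUnion fun T => insert (par T) (copies T)

/-- The phase gate on the qubit that holds the parity of `T` has the angle `c T`. -/
noncomputable def parGate (c : Finset L → ℝ) : L ⊕ ParityAncilla L → Matrix.unitaryGroup (Fin 2) ℂ :=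
  Sum.elim (fun _ => 1) (Sum.elim (fun _ => 1) fun T => phaseGate (c T))

lemma mem_copies {T : Finset L} {x : L ⊕ ParityAncilla L} :
    x ∈ copies T ↔ ∃ q ∈ T, x = copy T q := by
  simp [copies, eq_comm]

lemma mem_copiesOf {𝒯 : Finset (Finset L)} {q : L} {x : L ⊕ ParityAncilla L} :
    x ∈ copiesOf 𝒯 q ↔ ∃ T ∈ 𝒯, q ∈ T ∧ x = copy T q := by
  simp [copiesOf, eq_comm, and_assoc]

/-- The first half of the phase circuit, which copies the qubits. -/
noncomputable def copyLayer (𝒯 : Finset (Finset L)) : Circuit (L ⊕ ParityAncilla L) :=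
  fans Finset.univ Sum.inl (copiesOf 𝒯)

/-- The second half of the phase circuit, which computes the parities of the copies. -/
noncomputable def parityLayers (𝒯 : Finset (Finset L)) : Circuit (L ⊕ ParityAncilla L) :=
  singles (work 𝒯) (fun _ => hadamardGate) ++
    (fans 𝒯 par copies ++ singles (work 𝒯) fun _ => hadamardGate)

/-- The layer of phase gates. -/
noncomputable def phaseLayer (𝒯 : Finset (Finset L)) (c : Finset L → ℝ) :
    Circuit (L ⊕ ParityAncilla L) :=
  singles (𝒯.map ⟨par, fun _ _ h => Sum.inr_injective (Sum.inr_injective h)⟩) (parGate c)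

lemma copyLayer_control (𝒯 : Finset (Finset L)) :
    ∀ p ∈ Finset.univ, ∀ q ∈ Finset.univ, (Sum.inl p : L ⊕ ParityAncilla L) ∉ copiesOf 𝒯 q := by
  intro p _ q _ h
  simp [mem_copiesOf, copy] at h

lemma parityLayers_control (𝒯 : Finset (Finset L)) :
    ∀ S ∈ 𝒯, ∀ T ∈ 𝒯, par S ∉ copies T := by
  intro S _ T _ h
  simp [mem_copies, copy, par] at h

lemma toMatrix_copyLayer (𝒯 : Finset (Finset L)) :
    (copyLayer 𝒯).toMatrix = basisMap (fansMap Finset.univ Sum.inl (copiesOf 𝒯)) :=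
  toMatrix_fans _ (copyLayer_control 𝒯)

lemma toMatrix_parityLayers (𝒯 : Finset (Finset L)) :
    (parityLayers 𝒯).toMatrix = basisMap (parityMap 𝒯 par copies) := by
  have h : Circuit.toMatrix (singles (work 𝒯) fun _ => hadamardGate) = hadamards (work 𝒯) :=
    toMatrix_singles _ _
  rw [parityLayers, Circuit.toMatrix_append, Circuit.toMatrix_append,
    toMatrix_fans _ (parityLayers_control 𝒯), h, Matrix.mul_assoc,
    hadamards_conj_fansMap (parityLayers_control 𝒯)]
  · intro T hT
    exact Finset.mem_biUnion.2 ⟨T, hT, Finset.mem_insert_self _ _⟩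
  · intro T hT x hx
    exact Finset.mem_biUnion.2 ⟨T, hT, Finset.mem_insert_of_mem hx⟩

lemma toMatrix_phaseLayer (𝒯 : Finset (Finset L)) (c : Finset L → ℝ) :
    (phaseLayer 𝒯 c).toMatrix = phases fun w => ∑ T ∈ 𝒯, c T * (w (par T) : ℕ) := by
  rw [phaseLayer, toMatrix_singles]
  set A := 𝒯.map ⟨par, fun _ _ h => Sum.inr_injective (Sum.inr_injective h)⟩ with hA
  have h : (fun q => if q ∈ A then (parGate c q).1 else 1) = fun q =>
      Matrix.diagonal (if q ∈ A then phase ((Sum.elim 0 (Sum.elim 0 c) : _ → ℝ) q) else 1) := by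
    funext q
    split_ifs with hq
    · rw [hA, Finset.mem_map] at hq
      obtain ⟨T, _, rfl⟩ := hq
      rfl
    · exact Matrix.diagonal_one.symm
  rw [h, tensor_diagonal, phases]
  congr 1
  funext w
  rw [Complex.ofReal_sum, Finset.sum_mul, Complex.exp_sum]
  have : ∀ q, (if q ∈ A then phase ((Sum.elim 0 (Sum.elim 0 c) : _ → ℝ) q) else 1) (w q) =
      if q ∈ A then phase ((Sum.elim 0 (Sum.elim 0 c) : _ → ℝ) q) (w q) else 1 := by
    intro q; split_ifs <;> rfl
  rw [Finset.prod_congr rfl fun q _ => this q, Finset.prod_ite_mem, Finset.univ_inter, hA,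
    Finset.prod_map]
  rfl

/-- The phase circuit. -/
noncomputable def circuit (𝒯 : Finset (Finset L)) (c : Finset L → ℝ) :
    Circuit (L ⊕ ParityAncilla L) :=
  copyLayer 𝒯 ++ (parityLayers 𝒯 ++ (phaseLayer 𝒯 c ++ (parityLayers 𝒯 ++ copyLayer 𝒯)))

/-- The qubit `copy T q` is a target of the control `q` only, so it receives exactly `y q`; the
parity qubit of `T` then collects the copies belonging to `T`. -/
lemma parity_eq (𝒯 : Finset (Finset L)) {T : Finset L} (hT : T ∈ 𝒯) (y : Bits L) :
    parityMap 𝒯 par copies (fansMap Finset.univ Sum.inl (copiesOf 𝒯) (Sum.elim y 0)) (par T) =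
      ∑ q ∈ T, y q := by
  have h1 : fansMap Finset.univ Sum.inl (copiesOf 𝒯) (Sum.elim y 0) (par T) = 0 := by
    simp [fansMap, mem_copiesOf, par, copy]
  have h2 : ∀ q ∈ T, fansMap Finset.univ Sum.inl (copiesOf 𝒯) (Sum.elim y 0) (copy T q) = y q := by
    intro q hq
    have : ∀ p, copy T q ∈ copiesOf 𝒯 p ↔ p = q := by
      intro p
      rw [mem_copiesOf]
      constructor
      · rintro ⟨S, _, _, h⟩
        simp [copy] at h
        exact h.2.symm
      · rintro rfl
        exact ⟨T, hT, hq, rfl⟩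
    simp [fansMap, this]
    simp [copy]
  have h3 : ∀ S, par T = par S ↔ T = S := by simp [par]
  rw [parityMap, h1, zero_add]
  simp only [h3]
  rw [Finset.sum_ite_eq, if_pos hT, copies, Finset.sum_image]
  · exact Finset.sum_congr rfl h2
  · intro p _ q _ h
    simpa [copy] using h

lemma toMatrix_circuit (𝒯 : Finset (Finset L)) (c : Finset L → ℝ) :
    (circuit 𝒯 c).toMatrix * addZeros L (ParityAncilla L) =
      addZeros L (ParityAncilla L) * phases fun y => ∑ T ∈ 𝒯, c T * parity T y := by
  simp only [circuit, Circuit.toMatrix_append, toMatrix_copyLayer, toMatrix_parityLayers,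
    toMatrix_phaseLayer, Matrix.mul_assoc]
  have h := basisMap_conj_diagonal (fansMap_involutive (copyLayer_control 𝒯))
    (parityMap_involutive (parityLayers_control 𝒯))
    (fun w => Complex.exp (((∑ T ∈ 𝒯, c T * (w (par T) : ℕ) : ℝ) : ℂ) * Complex.I))
  simp only [← Matrix.mul_assoc] at h ⊢
  rw [phases, h]
  ext w x
  rw [← Sum.elim_comp_inl_inr w, mul_addZeros_apply, addZeros_mul_apply, phases,
    Matrix.diagonal_apply, Matrix.diagonal_apply]
  simp only [Sum.elim_eq_iff]
  by_cases h0 : w ∘ Sum.inr = 0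
  · by_cases hx : w ∘ Sum.inl = x
    · simp only [h0, hx, and_self, if_true]
      congr 3
      apply Finset.sum_congr rfl
      intro T hT
      rw [parity_eq 𝒯 hT, parity]
    · simp [hx]
  · simp [h0]

lemma depthLE_circuit (𝒯 : Finset (Finset L)) (c : Finset L → ℝ) : DepthLE (circuit 𝒯 c) 9 := by
  have h1 : DepthLE (copyLayer 𝒯) 1 := by
    apply depthLE_fans
    intro p _ q _ hpq
    rw [Finset.disjoint_left]
    intro x hx hx'
    simp only [Finset.mem_insert, mem_copiesOf] at hx hx'
    obtain rfl | ⟨S, _, _, rfl⟩ := hx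
    · simp [copy, hpq] at hx'
    · simp [copy, hpq] at hx'
  have h2 : DepthLE (fans 𝒯 par copies) 1 := by
    apply depthLE_fans
    intro S _ T _ hST
    rw [Finset.disjoint_left]
    intro x hx hx'
    simp only [Finset.mem_insert, mem_copies] at hx hx'
    obtain rfl | ⟨q, _, rfl⟩ := hx
    · simp [copy, par, hST] at hx'
    · simp [copy, par, hST] at hx'
  have h3 : DepthLE (parityLayers 𝒯) (1 + (1 + 1)) :=
    (depthLE_singles _ _).append (h2.append (depthLE_singles _ _))
  -- The depth is `1 + 3 + 1 + 3 + 1`.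
  exact h1.append (h3.append ((depthLE_singles _ _).append (h3.append h1)))

/-- Only ancillas belonging to sets in `𝒯` are touched; the exponentially many others cost nothing.
The two copy layers contribute `4 * T.card`, the two parity stages `8 * T.card + 4`, and the phase
gate 1. -/
lemma size_circuit_le (𝒯 : Finset (Finset L)) (c : Finset L → ℝ) :
    (circuit 𝒯 c).size ≤ ∑ T ∈ 𝒯, (12 * T.card + 5) := by
  have h1 : (copyLayer 𝒯).size ≤ ∑ T ∈ 𝒯, 2 * T.card := by
    refine (size_fans_le _ _ _).trans ?_
    rw [← Finset.mul_sum, ← Finset.mul_sum]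
    apply Nat.mul_le_mul_left
    calc ∑ q, (copiesOf 𝒯 q).card ≤ ∑ q, ({T ∈ 𝒯 | q ∈ T} : Finset (Finset L)).card :=
          Finset.sum_le_sum fun q _ => Finset.card_image_le
      _ = ∑ T ∈ 𝒯, T.card := by
          simp only [Finset.card_filter]
          rw [Finset.sum_comm]
          simp
  have hw : (work 𝒯).card ≤ ∑ T ∈ 𝒯, (T.card + 1) := by
    refine Finset.card_biUnion_le.trans (Finset.sum_le_sum fun T _ => ?_)
    exact (Finset.card_insert_le _ _).trans (Nat.succ_le_succ Finset.card_image_le)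
  have h2 : (parityLayers 𝒯).size ≤ ∑ T ∈ 𝒯, (4 * T.card + 2) := by
    rw [parityLayers, Circuit.size_append, Circuit.size_append, size_singles]
    have h3 : Circuit.size (fans 𝒯 par copies) ≤ ∑ T ∈ 𝒯, 2 * T.card :=
      (size_fans_le _ _ _).trans
        (Finset.sum_le_sum fun T _ => Nat.mul_le_mul_left _ Finset.card_image_le)
    have h4 : ∑ T ∈ 𝒯, (4 * T.card + 2) =
        ∑ T ∈ 𝒯, (T.card + 1) + ∑ T ∈ 𝒯, 2 * T.card + ∑ T ∈ 𝒯, (T.card + 1) := by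
      rw [← Finset.sum_add_distrib, ← Finset.sum_add_distrib]
      exact Finset.sum_congr rfl fun T _ => by ring
    omega
  have h3 : (phaseLayer 𝒯 c).size = ∑ T ∈ 𝒯, 1 := by
    rw [phaseLayer, size_singles, Finset.card_map, Finset.card_eq_sum_ones]
  have h4 : ∑ T ∈ 𝒯, (12 * T.card + 5) = ∑ T ∈ 𝒯, 2 * T.card + ∑ T ∈ 𝒯, (4 * T.card + 2) +
      ∑ T ∈ 𝒯, 1 + ∑ T ∈ 𝒯, (4 * T.card + 2) + ∑ T ∈ 𝒯, 2 * T.card := by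
    simp only [← Finset.sum_add_distrib]
    exact Finset.sum_congr rfl fun T _ => by ring
  simp only [circuit, Circuit.size_append]
  omega

end ParityPhase

/-! ### From monomials to parities. -/

/-- The monomial of the bits in `S`. -/
def monomial (S : Finset L) (y : Bits L) : ℝ := ∏ q ∈ S, ((y q : ℕ) : ℝ)

lemma parity_eq_prod (T : Finset L) (y : Bits L) :
    parity T y = (1 - ∏ q ∈ T, (1 - 2 * ((y q : ℕ) : ℝ))) / 2 := by
  have h : ∀ a b : Fin 2, (((a + b : Fin 2) : ℕ) : ℝ) =
      (1 - (1 - 2 * ((a : ℕ) : ℝ)) * (1 - 2 * ((b : ℕ) : ℝ))) / 2 := by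
    intro a b
    fin_cases a <;> fin_cases b <;> norm_num
  unfold parity
  induction T using Finset.induction_on with
  | empty => simp
  | insert q T hq ih =>
    rw [Finset.sum_insert hq, Finset.prod_insert hq, h, ih]
    ring

/-- Expand `∏ (1 - (1 - 2 y_q)) = 2 ^ |S| * ∏ y_q` into characters, which are `1 - 2 * parity`. The
constants cancel because `∑ (-1) ^ |T| = 0` for nonempty `S`; the constant monomial is out of reach,
as all parities vanish at 0. -/
lemma monomial_eq_sum_parity {S : Finset L} (hS : S.Nonempty) (y : Bits L) :
    monomial S y = ∑ T ∈ S.powerset, ((-1) ^ (T.card + 1) * 2 / 2 ^ S.card) * parity T y := by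
  have h1 : ∏ q ∈ S, (1 - (1 - 2 * ((y q : ℕ) : ℝ))) =
      ∑ T ∈ S.powerset, (-1) ^ T.card * ∏ q ∈ T, (1 - 2 * ((y q : ℕ) : ℝ)) := by
    simp only [sub_eq_add_neg (1 : ℝ), add_comm (1 : ℝ)]
    rw [Finset.prod_add]
    exact Finset.sum_congr rfl fun T _ => by rw [Finset.prod_const_one, mul_one, Finset.prod_neg]
  have h2 : ∑ T ∈ S.powerset, (-1 : ℝ) ^ T.card = 0 := by
    have := Finset.sum_powerset_neg_one_pow_card_of_nonempty hS
    exact_mod_cast this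
  have h3 : ∏ q ∈ S, (1 - (1 - 2 * ((y q : ℕ) : ℝ))) = 2 ^ S.card * monomial S y := by
    rw [monomial, ← Finset.prod_const, ← Finset.prod_mul_distrib]
    exact Finset.prod_congr rfl fun q _ => by ring
  have h4 : ∀ T ∈ S.powerset, ((-1) ^ (T.card + 1) * 2 / 2 ^ S.card) * parity T y =
      ((-1 : ℝ) ^ T.card * ∏ q ∈ T, (1 - 2 * ((y q : ℕ) : ℝ)) - (-1) ^ T.card) / 2 ^ S.card := by
    intro T _
    rw [parity_eq_prod]
    ring
  rw [Finset.sum_congr rfl h4, ← Finset.sum_div, Finset.sum_sub_distrib, h2, ← h1, h3, sub_zero,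
    mul_div_cancel_left₀ _ (by positivity)]

lemma realizes_phases {𝒮 : Finset (Finset L)} {d : ℕ} (h𝒮 : ∀ S ∈ 𝒮, S.Nonempty)
    (hd : ∀ S ∈ 𝒮, S.card ≤ d) {φ : Bits L → ℝ}
    (hφ : φ ∈ Submodule.span ℝ (monomial '' (𝒮 : Set (Finset L)))) :
    Realizes (ParityAncilla L) (phases φ) 9 (𝒮.card * (2 ^ d * (12 * d + 5))) := by
  -- A monomial of degree at most `d` needs only the parities of subsets of its support, at most `2
  -- ^ d` of them.
  set 𝒯 := 𝒮.biUnion Finset.powerset with h𝒯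
  have hle : Submodule.span ℝ (monomial '' (𝒮 : Set (Finset L))) ≤
      Submodule.span ℝ (parity '' (𝒯 : Set (Finset L))) := by
    rw [Submodule.span_le]
    rintro _ ⟨S, hS, rfl⟩
    have : monomial S =
        ∑ T ∈ S.powerset, ((-1) ^ (T.card + 1) * 2 / 2 ^ S.card : ℝ) • parity T := by
      funext y
      rw [monomial_eq_sum_parity (h𝒮 S hS), Finset.sum_apply]
      rfl
    rw [this]
    refine Submodule.sum_mem _ fun T hT => Submodule.smul_mem _ _ (Submodule.subset_span ?_)
    exact ⟨T, by simpa [h𝒯] using ⟨S, hS, by simpa using hT⟩, rfl⟩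
  obtain ⟨c, hc⟩ := (Submodule.mem_span_image_finset_iff_exists_fun' ℝ).1 (hle hφ)
  have hφ' : φ = fun y => ∑ T ∈ 𝒯, c T * parity T y := by
    rw [← hc]
    funext y
    rw [Finset.sum_apply]
    rfl
  refine ⟨ParityPhase.circuit 𝒯 c, ParityPhase.depthLE_circuit 𝒯 c, ?_,
    by rw [hφ']; exact ParityPhase.toMatrix_circuit 𝒯 c⟩
  refine (ParityPhase.size_circuit_le 𝒯 c).trans ?_
  calc ∑ T ∈ 𝒯, (12 * T.card + 5) ≤ ∑ T ∈ 𝒯, (12 * d + 5) := by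
        refine Finset.sum_le_sum fun T hT => ?_
        obtain ⟨S, hS, hTS⟩ := Finset.mem_biUnion.1 hT
        have := (Finset.card_le_card (Finset.mem_powerset.1 hTS)).trans (hd S hS)
        omega
    _ = 𝒯.card * (12 * d + 5) := by rw [Finset.sum_const, smul_eq_mul]
    _ ≤ (𝒮.card * 2 ^ d) * (12 * d + 5) := by
        apply Nat.mul_le_mul_right
        refine Finset.card_biUnion_le_card_mul _ _ _ fun S hS => ?_
        rw [Finset.card_powerset]
        exact Nat.pow_le_pow_right (by norm_num) (hd S hS)
    _ = _ := by ring

end ParityPhase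

/-! ### Rotations by state-dependent angles. -/

/-- The one-qubit operator `H · diag(1, exp(iθ)) · H`. -/
noncomputable def xRotation (θ : ℝ) : Matrix (Fin 2) (Fin 2) ℂ :=
  hadamard * (Matrix.diagonal (phase θ) * hadamard)

lemma xRotation_of_exp_eq {θ : ℝ} {c : Fin 2}
    (h : Complex.exp ((θ : ℂ) * Complex.I) = if c = 1 then -1 else 1) (a b : Fin 2) :
    xRotation θ a b = if a = b + c then 1 else 0 := by
  have h2 : (((√2 : ℝ) : ℂ)⁻¹) * ((√2 : ℝ) : ℂ)⁻¹ = 2⁻¹ := by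
    rw [← mul_inv, ← Complex.ofReal_mul, Real.mul_self_sqrt (by norm_num)]
    norm_num
  have key : xRotation θ a b = 2⁻¹ * (bitSign a 0 * bitSign 0 b +
      Complex.exp ((θ : ℂ) * Complex.I) * (bitSign a 1 * bitSign 1 b)) := by
    have e0 : phase θ 0 = 1 := by simp [phase]
    have e1 : phase θ 1 = Complex.exp ((θ : ℂ) * Complex.I) := by simp [phase]
    rw [xRotation, Matrix.mul_apply, Fin.sum_univ_two, Matrix.diagonal_mul, Matrix.diagonal_mul,
      e0, e1, ← h2]
    simp only [hadamard, Matrix.of_apply]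
    ring
  rw [key, h]
  fin_cases a <;> fin_cases b <;> fin_cases c <;> norm_num [bitSign, fin_two_add_self]

section Rotation

variable {L I : Type} [Fintype L] [DecidableEq L] [Fintype I]

/-- Rotation of the qubits `a i` by angles that depend on the state of the other qubits. -/
noncomputable def rotation (a : I ↪ L) (θ : I → Bits L → ℝ) : Matrix (Bits L) (Bits L) ℂ :=
  hadamards (Finset.univ.map a) *
    (phases (fun y => ∑ i, θ i y * ((y (a i) : ℕ) : ℝ)) * hadamards (Finset.univ.map a))

lemma rotation_neg_mul (a : I ↪ L) (θ : I → Bits L → ℝ) :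
    rotation a (-θ) * rotation a θ = 1 := by
  have h : phases (fun y => ∑ i, (-θ) i y * ((y (a i) : ℕ) : ℝ)) *
      phases (fun y => ∑ i, θ i y * ((y (a i) : ℕ) : ℝ)) = (1 : Matrix (Bits L) (Bits L) ℂ) := by
    rw [phases, phases, Matrix.diagonal_mul_diagonal, ← Matrix.diagonal_one]
    congr 1
    funext y
    rw [← Complex.exp_add, ← add_mul, ← Complex.ofReal_add, ← Finset.sum_add_distrib,
      Finset.sum_eq_zero fun i _ => by simp]
    simp
  calc rotation a (-θ) * rotation a θ
      = hadamards (Finset.univ.map a) * (phases (fun y => ∑ i, (-θ) i y * ((y (a i) : ℕ) : ℝ)) *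
          ((hadamards (Finset.univ.map a) * hadamards (Finset.univ.map a)) *
          (phases (fun y => ∑ i, θ i y * ((y (a i) : ℕ) : ℝ)) *
            hadamards (Finset.univ.map a)))) := by
        simp only [rotation, Matrix.mul_assoc]
    _ = 1 := by
        rw [hadamards_mul_self, Matrix.one_mul, ← Matrix.mul_assoc (phases _), h, Matrix.one_mul,
          hadamards_mul_self]

/-- The Hadamards alter only the qubits `a i`, on which the angles do not depend. In the column `x`
the angles are thus constants, and the operator factors into one-qubit operators. -/
lemma rotation_apply {a : I ↪ L} {θ : I → Bits L → ℝ} {x : Bits L}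
    (h : ∀ i y, (∀ q, (∀ j, q ≠ a j) → y q = x q) → θ i y = θ i x) (y : Bits L) :
    rotation a θ y x = (if ∀ q, (∀ j, q ≠ a j) → y q = x q then 1 else 0) *
      ∏ i, xRotation (θ i x) (y (a i)) (x (a i)) := by
  have hA : ∀ q, q ∉ Finset.univ.map a ↔ ∀ j, q ≠ a j := by
    intro q; simp [eq_comm]
  set A := Finset.univ.map a
  set η : L → ℝ := Function.extend a (fun i => θ i x) 0
  have hη : ∀ i, η (a i) = θ i x := fun i => a.injective.extend_apply _ _ _
  have e1 : rotation a θ y x =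
      (hadamards A * (tensor (fun q => if q ∈ A then Matrix.diagonal (phase (η q)) else 1) *
        hadamards A)) y x := by
    have : (fun q => if q ∈ A then Matrix.diagonal (phase (η q)) else 1) = fun q =>
        Matrix.diagonal (if q ∈ A then phase (η q) else 1) := by
      funext q
      split_ifs
      · rfl
      · exact Matrix.diagonal_one.symm
    rw [this, tensor_diagonal, rotation, phases, Matrix.mul_apply, Matrix.mul_apply]
    apply Finset.sum_congr rfl
    intro z _
    rw [Matrix.diagonal_mul, Matrix.diagonal_mul]
    by_cases hz : ∀ q, q ∉ A → z q = x q
    · congr 2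
      have hprod : ∏ q, (if q ∈ A then phase (η q) else 1) (z q) =
          ∏ i, phase (θ i x) (z (a i)) := by
        have : ∀ q, (if q ∈ A then phase (η q) else 1) (z q) =
            if q ∈ A then phase (η q) (z q) else 1 := by
          intro q; split_ifs <;> rfl
        rw [Finset.prod_congr rfl fun q _ => this q, Finset.prod_ite_mem, Finset.univ_inter,
          Finset.prod_map]
        simp only [hη]
      rw [hprod, Complex.ofReal_sum, Finset.sum_mul, Complex.exp_sum]
      apply Finset.prod_congr rfl
      intro i _
      rw [h i z fun q hq => hz q ((hA q).2 hq), phase]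
    · have : hadamards A z x = 0 := by rw [hadamards_apply, if_neg hz, zero_mul]
      simp only [show hadamards (Finset.univ.map a) z x = 0 from this, this, mul_zero]
  rw [e1, hadamards, tensor_mul, tensor_mul]
  simp only [tensor, Matrix.of_apply]
  rw [← Finset.prod_compl_mul_prod A]
  congr 1
  · simp only [← hA]
    split_ifs with hy
    · apply Finset.prod_eq_one
      intro q hq
      rw [Finset.mem_compl] at hq
      simp only [if_neg hq, mul_one]
      rw [hy q hq, Matrix.one_apply_eq]
    · push Not at hy
      obtain ⟨q, hq, hne⟩ := hy
      apply Finset.prod_eq_zero (Finset.mem_compl.2 hq)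
      simp only [if_neg hq, mul_one]
      exact Matrix.one_apply_ne hne
  · rw [Finset.prod_map]
    apply Finset.prod_congr rfl
    intro i _
    have : a i ∈ A := Finset.mem_map_of_mem a (Finset.mem_univ i)
    simp only [if_pos this, hη, xRotation]

/-- The basis state with the bits `c i` at the positions `a i`, and zero elsewhere. -/
def spread (a : I ↪ L) (c : I → Fin 2) : Bits L := fun q => ∑ i, if q = a i then c i else 0

omit [Fintype L] in
lemma spread_apply (a : I ↪ L) (c : I → Fin 2) (i : I) : spread a c (a i) = c i := by
  classical
  simp [spread]

omit [Fintype L] in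
lemma spread_eq_zero (a : I ↪ L) (c : I → Fin 2) {q : L} (hq : ∀ i, q ≠ a i) :
    spread a c q = 0 := by
  simp [spread, hq]

lemma rotation_mulVec_ket {a : I ↪ L} {θ : I → Bits L → ℝ} {x : Bits L}
    (h : ∀ i y, (∀ q, (∀ j, q ≠ a j) → y q = x q) → θ i y = θ i x) {c : I → Fin 2}
    (hc : ∀ i, Complex.exp ((θ i x : ℂ) * Complex.I) = if c i = 1 then -1 else 1) :
    rotation a θ *ᵥ ket x = ket (x + spread a c) := by
  funext y
  rw [ket, Matrix.mulVec_single_one, Matrix.col_apply, rotation_apply h]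
  simp only [xRotation_of_exp_eq (hc _)]
  rw [ket, Pi.single_apply]
  by_cases hy : y = x + spread a c
  · subst hy
    rw [if_pos, if_pos rfl, Finset.prod_eq_one, one_mul]
    · intro i _
      simp [spread_apply]
    · intro q hq
      simp [spread_eq_zero a c hq]
  · rw [if_neg hy]
    by_contra hne
    apply hy
    rw [mul_eq_zero, not_or] at hne
    have h1 : ∀ q, (∀ j, q ≠ a j) → y q = x q := by
      by_contra h1
      exact hne.1 (if_neg h1)
    have h2 := Finset.prod_ne_zero_iff.1 hne.2
    funext q
    by_cases hq : ∀ j, q ≠ a j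
    · simp [h1 q hq, spread_eq_zero a c hq]
    · push Not at hq
      obtain ⟨j, rfl⟩ := hq
      have := h2 j (Finset.mem_univ j)
      rw [Pi.add_apply, spread_apply]
      by_contra h3
      exact this (if_neg h3)

omit [DecidableEq L] in
lemma bits_add_self (x : Bits L) : x + x = 0 := by
  funext q
  exact fin_two_add_self _

/-- On each branch `y` of `V |x⟩` the operator `W` adds the same `δ`, and `V` commutes with this
shift. Hence `W V |x⟩ = V |x + δ⟩`, and `V'` removes the superposition. -/
lemma conj_mulVec_ket {V V' W : Matrix (Bits L) (Bits L) ℂ} (hV : V' * V = 1) {x δ : Bits L}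
    (hW : ∀ y, V y x ≠ 0 → W *ᵥ ket y = ket (y + δ))
    (hδ : ∀ y, V (y + δ) (x + δ) = V y x) :
    (V' * (W * V)) *ᵥ ket x = ket (x + δ) := by
  have key : (W * V) *ᵥ ket x = V *ᵥ ket (x + δ) := by
    funext w
    simp only [ket, Matrix.mulVec_single_one, Matrix.col_apply]
    rw [Matrix.mul_apply]
    have : ∀ y, W w y * V y x = if y = w + δ then V y x else 0 := by
      intro y
      by_cases hy : V y x = 0
      · simp [hy]
      · have h1 := congrFun (hW y hy) w
        simp only [ket, Matrix.mulVec_single_one, Matrix.col_apply, Pi.single_apply] at h1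
        have h2 : (w = y + δ) ↔ (y = w + δ) := by
          constructor <;> rintro rfl <;> rw [add_assoc, bits_add_self, add_zero]
        rw [h1]
        simp only [h2]
        split_ifs <;> simp
    rw [Finset.sum_congr rfl fun y _ => this y, Finset.sum_ite_eq' Finset.univ (w + δ),
      if_pos (Finset.mem_univ _), ← hδ, add_assoc, bits_add_self, add_zero]
  rw [← Matrix.mulVec_mulVec, key, Matrix.mulVec_mulVec, hV, Matrix.one_mulVec]

end Rotation

/-! ### The exact congruence test modulo a power of two. -/

section Selection

variable {L J : Type} [Fintype L] [DecidableEq L] [Fintype J] {m : ℕ}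

/-- The angles by which the work qubits for the test `s ≡ v j` modulo `2 ^ m` are rotated. -/
noncomputable def testAngle (v : J → ℤ) (s : Bits L → ℝ) (i : J × Fin m) (y : Bits L) : ℝ :=
  2 * Real.pi * (2 ^ (i.2 : ℕ) / 2 ^ m) * (s y - v i.1) + Real.pi

/-- The angles by which the result qubits of the tests are rotated. -/
noncomputable def resultAngle (a : J × Fin m ↪ L) (j : J) (y : Bits L) : ℝ :=
  Real.pi * ∏ k, ((y (a (j, k)) : ℕ) : ℝ)

/-- The operator that tests for every `j` whether `s ≡ v j` modulo `2 ^ m`, and adds the result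
to the qubit `e j`. -/
noncomputable def select (a : J × Fin m ↪ L) (e : J ↪ L) (v : J → ℤ) (s : Bits L → ℝ) :
    Matrix (Bits L) (Bits L) ℂ :=
  rotation a (-testAngle v s) * (rotation e (resultAngle a) * rotation a (testAngle v s))

lemma exp_testAngle_of_dvd {v : J → ℤ} {s : Bits L → ℝ} {x : Bits L} {σ : ℤ} (hσ : s x = σ)
    {j : J} (h : (2 : ℤ) ^ m ∣ σ - v j) (k : Fin m) :
    Complex.exp ((testAngle v s (j, k) x : ℂ) * Complex.I) = -1 := by
  obtain ⟨t, ht⟩ := h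
  -- Under the congruence the linear part is a multiple of `2π`, and the offset `π` flips every work
  -- qubit.
  have : testAngle v s (j, k) x = ((2 ^ (k : ℕ) * t : ℤ) : ℝ) * (2 * Real.pi) + Real.pi := by
    have : ((σ : ℝ) - v j) = 2 ^ m * t := by exact_mod_cast ht
    rw [testAngle, hσ, this]
    push_cast
    field_simp
  rw [this, Complex.ofReal_add, add_mul, Complex.exp_add, Complex.exp_pi_mul_I]
  have : Complex.exp (((((2 ^ (k : ℕ) * t : ℤ) : ℝ) * (2 * Real.pi) : ℝ) : ℂ) * Complex.I) = 1 := by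
    rw [← Complex.exp_int_mul_two_pi_mul_I (2 ^ (k : ℕ) * t)]
    congr 1
    push_cast
    ring
  rw [this, one_mul]

/-- If `2 ^ u` is the exact power of two in `d`, then `k = m - 1 - u` makes `2 ^ k * d / 2 ^ m` a
half-integer. The corresponding test angle, with its offset `π`, is then a multiple of `2π`, so that
work qubit stays 0. -/
lemma exists_two_pow_mul_eq_odd {d : ℤ} (h : ¬ (2 : ℤ) ^ m ∣ d) :
    ∃ (k : Fin m) (t : ℤ), 2 ^ (k : ℕ) * d * 2 = 2 ^ m * (2 * t + 1) := by
  induction m with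
  | zero => simp at h
  | succ m ih =>
    by_cases hd : (2 : ℤ) ^ m ∣ d
    · obtain ⟨u, rfl⟩ := hd
      obtain ⟨t, rfl⟩ | ⟨t, rfl⟩ := Int.even_or_odd u
      · exact absurd ⟨t, by ring⟩ h
      · exact ⟨0, t, by simp; ring⟩
    · obtain ⟨k, t, hk⟩ := ih hd
      exact ⟨k.succ, t, by rw [Fin.val_succ, pow_succ, pow_succ]; linear_combination 2 * hk⟩

lemma exists_exp_testAngle_eq_one {v : J → ℤ} {s : Bits L → ℝ} {x : Bits L} {σ : ℤ}
    (hσ : s x = σ) {j : J} (h : ¬ (2 : ℤ) ^ m ∣ σ - v j) :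
    ∃ k : Fin m, Complex.exp ((testAngle v s (j, k) x : ℂ) * Complex.I) = 1 := by
  obtain ⟨k, t, hk⟩ := exists_two_pow_mul_eq_odd h
  refine ⟨k, ?_⟩
  have : testAngle v s (j, k) x = ((t + 1 : ℤ) : ℝ) * (2 * Real.pi) := by
    have h1 : (2 : ℝ) ^ (k : ℕ) * ((σ : ℝ) - v j) * 2 = 2 ^ m * (2 * t + 1) := by exact_mod_cast hk
    have h2 : (2 : ℝ) ^ (k : ℕ) / 2 ^ m * ((σ : ℝ) - v j) = (2 * t + 1) / 2 := by
      field_simp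
      linear_combination h1
    rw [testAngle, hσ, mul_assoc, h2]
    push_cast
    ring
  rw [this, ← Complex.exp_int_mul_two_pi_mul_I (t + 1)]
  congr 1
  push_cast
  ring

lemma select_mulVec_ket {a : J × Fin m ↪ L} {e : J ↪ L} {v : J → ℤ} {s : Bits L → ℝ}
    (hae : ∀ i j, a i ≠ e j)
    (hs : ∀ x y : Bits L, (∀ q, (∀ i, q ≠ a i) → (∀ j, q ≠ e j) → x q = y q) → s x = s y)
    {x : Bits L} (hx : ∀ i, x (a i) = 0) {σ : ℤ} (hσ : s x = σ) :
    select a e v s *ᵥ ket x =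
      ket (x + spread e fun j => if (2 : ℤ) ^ m ∣ σ - v j then 1 else 0) := by
  have hθ : ∀ (x : Bits L) (i : J × Fin m) (y : Bits L), (∀ q, (∀ j, q ≠ a j) → y q = x q) →
      testAngle v s i y = testAngle v s i x := by
    intro x i y h
    rw [testAngle, testAngle, hs y x fun q hq _ => h q hq]
  set c : J → Fin 2 := fun j => if (2 : ℤ) ^ m ∣ σ - v j then 1 else 0
  apply conj_mulVec_ket (rotation_neg_mul a _)
  -- In a branch of nonzero amplitude the deterministic work qubits have their forced values, which
  -- already determine the product in `resultAngle`.
  · intro y hy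
    rw [rotation_apply (hθ x)] at hy
    have hy2 := Finset.prod_ne_zero_iff.1 (right_ne_zero_of_mul hy)
    apply rotation_mulVec_ket
    · intro j z hz
      rw [resultAngle, resultAngle]
      congr 1
      exact Finset.prod_congr rfl fun k _ => by rw [hz _ (hae _)]
    · intro j
      by_cases hj : (2 : ℤ) ^ m ∣ σ - v j
      · have h1 : ∀ k, y (a (j, k)) = 1 := by
          intro k
          have := hy2 (j, k) (Finset.mem_univ _)
          rw [xRotation_of_exp_eq (c := 1) (by simpa using exp_testAngle_of_dvd hσ hj k), hx,
            zero_add] at this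
          by_contra h
          exact this (if_neg h)
        simp [resultAngle, h1, hj, c]
      · obtain ⟨k, hk⟩ := exists_exp_testAngle_eq_one hσ hj
        have h1 : y (a (j, k)) = 0 := by
          have := hy2 (j, k) (Finset.mem_univ _)
          rw [xRotation_of_exp_eq (c := 0) (by simpa using hk), hx, zero_add] at this
          by_contra h
          exact this (if_neg h)
        have h2 : ∏ k, ((y (a (j, k)) : ℕ) : ℝ) = 0 :=
          Finset.prod_eq_zero (Finset.mem_univ k) (by simp [h1])
        simp [resultAngle, h2, hj, c]
  -- Neither the value of `s` nor the work qubits see the result qubits, so the test rotation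
  -- commutes with the change made there.
  · intro y
    have h1 : ∀ i, spread e c (a i) = 0 := fun i => spread_eq_zero e c (hae i)
    rw [rotation_apply (hθ _), rotation_apply (hθ _)]
    have h2 : s (x + spread e c) = s x := by
      apply hs
      intro q _ hq
      simp [spread_eq_zero e c hq]
    have h3 : ∀ i : J × Fin m, testAngle v s i (x + spread e c) = testAngle v s i x := by
      intro i
      rw [testAngle, testAngle, h2]
    simp only [Pi.add_apply, h1, h3, add_zero, add_left_inj]

end Selection

/-! ### Cost of the rotations and of the congruence test. -/

section RealizeRotation

variable {L I J : Type} [Fintype L] [DecidableEq L] [Fintype I] [Fintype J] {m : ℕ}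

lemma realizes_rotation {a : I ↪ L} {θ : I → Bits L → ℝ} {𝒮 : Finset (Finset L)} {d : ℕ}
    (h𝒮 : ∀ S ∈ 𝒮, S.Nonempty) (hd : ∀ S ∈ 𝒮, S.card ≤ d)
    (hθ : (fun y => ∑ i, θ i y * ((y (a i) : ℕ) : ℝ)) ∈
      Submodule.span ℝ (monomial '' (𝒮 : Set (Finset L)))) :
    Realizes (ParityAncilla L) (rotation a θ) 11
      (2 * Fintype.card I + 𝒮.card * (2 ^ d * (12 * d + 5))) := by
  have hH : Realizes (ParityAncilla L) (hadamards (Finset.univ.map a)) 1 (Fintype.card I) := by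
    simpa using realizes_hadamards (K := ParityAncilla L) (Finset.univ.map a)
  have h := hH.mul ((realizes_phases h𝒮 hd hθ).mul hH)
  rw [show 2 * Fintype.card I + 𝒮.card * (2 ^ d * (12 * d + 5)) =
    Fintype.card I + 𝒮.card * (2 ^ d * (12 * d + 5)) + Fintype.card I by ring]
  exact h

/-- An affine function of the bits. -/
def affine (c : ℝ) (w : L → ℝ) (y : Bits L) : ℝ := c + ∑ q, w q * ((y q : ℕ) : ℝ)

/-- The sets of qubits whose monomials occur in products of the bits `a i` with affine functions
of the bits in `B`. -/
def affineSets (a : I ↪ L) (B : Finset L) : Finset (Finset L) :=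
  (Finset.univ.image fun i => {a i}) ∪ (Finset.univ ×ˢ B).image fun p => {a p.1, p.2}

lemma card_affineSets_le (a : I ↪ L) (B : Finset L) :
    (affineSets a B).card ≤ Fintype.card I * (1 + B.card) := by
  refine (Finset.card_union_le _ _).trans ?_
  rw [mul_add, mul_one]
  refine Nat.add_le_add (Finset.card_image_le.trans le_rfl) (Finset.card_image_le.trans ?_)
  rw [Finset.card_product]
  exact le_rfl

lemma affine_mul_mem_span {a : I ↪ L} {B : Finset L} (ha : ∀ i, a i ∉ B) {c : ℝ} {w : L → ℝ}
    (hw : ∀ q, q ∉ B → w q = 0) (α β : I → ℝ) :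
    (fun y => ∑ i, (α i * affine c w y + β i) * ((y (a i) : ℕ) : ℝ)) ∈
      Submodule.span ℝ (monomial '' (affineSets a B : Set (Finset L))) := by
  have h : (fun y : Bits L => ∑ i, (α i * affine c w y + β i) * ((y (a i) : ℕ) : ℝ)) =
      ∑ i, ((α i * c + β i) • monomial {a i} +
        ∑ q ∈ B, (α i * w q) • monomial {a i, q}) := by
    funext y
    rw [Finset.sum_apply]
    apply Finset.sum_congr rfl
    intro i _
    have h1 : ∑ q, w q * ((y q : ℕ) : ℝ) = ∑ q ∈ B, w q * ((y q : ℕ) : ℝ) := by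
      symm
      apply Finset.sum_subset (Finset.subset_univ B)
      intro q _ hq
      rw [hw q hq, zero_mul]
    rw [Pi.add_apply, Pi.smul_apply, Finset.sum_apply, affine, h1]
    have h2 : ∀ q ∈ B, ((α i * w q) • monomial {a i, q}) y =
        (α i * (w q * ((y q : ℕ) : ℝ))) * ((y (a i) : ℕ) : ℝ) := by
      intro q hq
      have : a i ≠ q := fun h => ha i (h ▸ hq)
      rw [Pi.smul_apply, monomial, Finset.prod_pair this, smul_eq_mul]
      ring
    rw [Finset.sum_congr rfl h2, ← Finset.sum_mul, ← Finset.mul_sum, monomial,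
      Finset.prod_singleton, smul_eq_mul]
    ring
  rw [h]
  refine Submodule.sum_mem _ fun i _ => Submodule.add_mem _ ?_ (Submodule.sum_mem _ fun q hq => ?_)
  · refine Submodule.smul_mem _ _ (Submodule.subset_span ⟨_, ?_, rfl⟩)
    simp [affineSets]
  · refine Submodule.smul_mem _ _ (Submodule.subset_span ⟨_, ?_, rfl⟩)
    rw [affineSets, Finset.coe_union]
    right
    simp only [Finset.coe_image]
    exact ⟨(i, q), by simpa using hq, rfl⟩

lemma realizes_rotation_affine {a : I ↪ L} {B : Finset L} (ha : ∀ i, a i ∉ B) {c : ℝ}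
    {w : L → ℝ} (hw : ∀ q, q ∉ B → w q = 0) (α β : I → ℝ) :
    Realizes (ParityAncilla L) (rotation a fun i y => α i * affine c w y + β i) 11
      (118 * (Fintype.card I * (1 + B.card))) := by
  have h := realizes_rotation (d := 2) (𝒮 := affineSets a B) (a := a)
    (θ := fun i y => α i * affine c w y + β i) ?_ ?_ (affine_mul_mem_span ha hw α β)
  · obtain ⟨C, hC, hs, hm⟩ := h
    refine ⟨C, hC, hs.trans ?_, hm⟩
    have := card_affineSets_le a B
    -- Degree 2 costs `2 ^ 2 * (12 * 2 + 5) = 116` per monomial, and the Hadamards add 2 per rotated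
    -- qubit.
    nlinarith [Nat.zero_le (Fintype.card I * B.card)]
  · intro S hS
    simp only [affineSets, Finset.mem_union, Finset.mem_image] at hS
    obtain ⟨i, _, rfl⟩ | ⟨p, _, rfl⟩ := hS <;> simp
  · intro S hS
    simp only [affineSets, Finset.mem_union, Finset.mem_image] at hS
    obtain ⟨i, _, rfl⟩ | ⟨p, _, rfl⟩ := hS
    · simp
    · exact Finset.card_le_two

/-- One monomial of degree `m + 1` per result qubit. The factor `2 ^ (m + 1)` from its parities is
affordable because `m` is logarithmic in `n`. -/
lemma realizes_rotation_resultAngle {a : J × Fin m ↪ L} {e : J ↪ L} (hae : ∀ i j, a i ≠ e j) :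
    Realizes (ParityAncilla L) (rotation e (resultAngle a)) 11
      (2 * Fintype.card J +
        Fintype.card J * (2 ^ (m + 1) * (12 * (m + 1) + 5))) := by
  have hn : ∀ j, e j ∉ Finset.univ.image fun k => a (j, k) := by
    intro j h
    obtain ⟨k, _, hk⟩ := Finset.mem_image.1 h
    exact hae _ _ hk
  have h := realizes_rotation (d := m + 1) (a := e) (θ := resultAngle a)
    (𝒮 := Finset.univ.image fun j => insert (e j) (Finset.univ.image fun k => a (j, k))) ?_ ?_ ?_
  · obtain ⟨C, hC, hs, hm⟩ := h
    exact ⟨C, hC, hs.trans (Nat.add_le_add_left (Nat.mul_le_mul_right _ Finset.card_image_le) _), hm⟩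
  · intro S hS
    obtain ⟨j, _, rfl⟩ := Finset.mem_image.1 hS
    exact Finset.insert_nonempty _ _
  · intro S hS
    obtain ⟨j, _, rfl⟩ := Finset.mem_image.1 hS
    refine (Finset.card_insert_le _ _).trans (Nat.succ_le_succ ?_)
    exact Finset.card_image_le.trans (by simp)
  · have : (fun y => ∑ j, resultAngle a j y * ((y (e j) : ℕ) : ℝ)) =
        ∑ j, Real.pi • monomial (insert (e j) (Finset.univ.image fun k => a (j, k))) := by
      funext y
      rw [Finset.sum_apply]
      apply Finset.sum_congr rfl
      intro j _
      rw [Pi.smul_apply, monomial, Finset.prod_insert (hn j), Finset.prod_image, resultAngle,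
        smul_eq_mul]
      · ring
      · intro k _ l _ h
        simpa using a.injective h
    rw [this]
    refine Submodule.sum_mem _ fun j _ => Submodule.smul_mem _ _ (Submodule.subset_span ⟨_, ?_, rfl⟩)
    simp

lemma realizes_select {a : J × Fin m ↪ L} {e : J ↪ L} (hae : ∀ i j, a i ≠ e j) {B : Finset L}
    (ha : ∀ i, a i ∉ B) {c : ℝ} {w : L → ℝ} (hw : ∀ q, q ∉ B → w q = 0) (v : J → ℤ) :
    Realizes (ParityAncilla L) (select a e v (affine c w)) 33
      (236 * (Fintype.card J * m * (1 + B.card)) + 2 * Fintype.card J +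
        Fintype.card J * (2 ^ (m + 1) * (12 * (m + 1) + 5))) := by
  have h1 := realizes_rotation_affine ha (c := c) hw
    (fun i => 2 * Real.pi * (2 ^ (i.2 : ℕ) / 2 ^ m))
    (fun i => Real.pi - 2 * Real.pi * (2 ^ (i.2 : ℕ) / 2 ^ m) * v i.1)
  have h2 := realizes_rotation_affine ha (c := c) hw
    (fun i => -(2 * Real.pi * (2 ^ (i.2 : ℕ) / 2 ^ m)))
    (fun i => -(Real.pi - 2 * Real.pi * (2 ^ (i.2 : ℕ) / 2 ^ m) * v i.1))
  have e1 : (fun (i : J × Fin m) y => 2 * Real.pi * (2 ^ (i.2 : ℕ) / 2 ^ m) * affine c w y +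
      (Real.pi - 2 * Real.pi * (2 ^ (i.2 : ℕ) / 2 ^ m) * v i.1)) = testAngle v (affine c w) := by
    funext i y
    rw [testAngle]
    ring
  have e2 : (fun (i : J × Fin m) y => -(2 * Real.pi * (2 ^ (i.2 : ℕ) / 2 ^ m)) * affine c w y +
      -(Real.pi - 2 * Real.pi * (2 ^ (i.2 : ℕ) / 2 ^ m) * v i.1)) = -testAngle v (affine c w) := by
    funext i y
    rw [Pi.neg_apply, Pi.neg_apply, testAngle]
    ring
  rw [e1] at h1
  rw [e2] at h2
  obtain ⟨C, hC, hs, hm⟩ := h2.mul ((realizes_rotation_resultAngle hae).mul h1)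
  refine ⟨C, hC, hs.trans (le_of_eq ?_), hm⟩
  rw [Fintype.card_prod, Fintype.card_fin]
  ring

end RealizeRotation

/-! ### Digits of the shifted Hamming weight and the threshold operator. -/

section Threshold

variable (n m : ℕ)

/-- The qubits that hold the digits, in unary notation, and the work qubits of the tests. -/
abbrev DigitQubits : Type := (Fin 3 × Fin (2 ^ m)) ⊕ (Fin (2 ^ m) × Fin m)

/-- The qubits of the threshold circuit, without the ancillary qubits of the phase circuits. -/
abbrev ThresholdQubits : Type := Fin n ⊕ Fin 1 ⊕ DigitQubits m

/-- The work qubits of the tests. -/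
def testQubit : Fin (2 ^ m) × Fin m ↪ ThresholdQubits n m :=
  ⟨fun i => Sum.inr (Sum.inr (Sum.inr i)), fun _ _ h => by simpa using h⟩

/-- The qubits that hold the digit `r`. -/
def digitQubit (r : Fin 3) : Fin (2 ^ m) ↪ ThresholdQubits n m :=
  ⟨fun j => Sum.inr (Sum.inr (Sum.inl (r, j))), fun _ _ h => by simpa using h⟩

/-- The output qubit. -/
def outputQubit : Fin 1 ↪ ThresholdQubits n m :=
  ⟨fun i => Sum.inr (Sum.inl i), fun _ _ h => by simpa using h⟩

variable {n m} in
lemma testQubit_apply (i : Fin (2 ^ m) × Fin m) :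
    testQubit n m i = Sum.inr (Sum.inr (Sum.inr i)) := rfl

variable {n m} in
lemma digitQubit_apply (r : Fin 3) (j : Fin (2 ^ m)) :
    digitQubit n m r j = Sum.inr (Sum.inr (Sum.inl (r, j))) := rfl

variable {n m} in
lemma outputQubit_apply (i : Fin 1) : outputQubit n m i = Sum.inr (Sum.inl i) := rfl

/-- The input qubits and the qubits that hold the digits. -/
def numberQubits : Finset (ThresholdQubits n m) :=
  (Finset.univ.image Sum.inl) ∪ Finset.univ.image fun p => Sum.inr (Sum.inr (Sum.inl p))

/-- The weights for which the weighted sum of the bits is the Hamming weight of the input,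
without its `r` lowest digits, shifted by `r` digits. -/
noncomputable def shiftWeight (r : ℕ) : ThresholdQubits n m → ℝ :=
  Sum.elim (fun _ => 1 / (2 ^ m) ^ r) (Sum.elim 0 (Sum.elim
    (fun p => if (p.1 : ℕ) < r then -((2 ^ m) ^ (p.1 : ℕ) * (p.2 : ℕ)) / (2 ^ m) ^ r else 0) 0))

variable {n m}

/-- The number whose highest digit decides whether the Hamming weight of `x` is at least `t`. -/
def offsetWeight (m t : ℕ) (x : Fin n → Fin 2) : ℕ := ((2 ^ m) ^ 3 - t) + ∑ i, (x i : ℕ)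

/-- The state in which the lowest `r` digits of `s` have been computed. -/
def digitState (x : Fin n → Fin 2) (z : Fin 2) (s r : ℕ) : Bits (ThresholdQubits n m) :=
  Sum.elim x (Sum.elim (fun _ => z) (Sum.elim
    (fun p => if (p.1 : ℕ) < r ∧ s / (2 ^ m) ^ (p.1 : ℕ) % 2 ^ m = p.2 then 1 else 0) 0))

/-- The number `offsetWeight`, shifted by `r` digits, as a function of the state. -/
noncomputable def shifted (n m t r : ℕ) : Bits (ThresholdQubits n m) → ℝ :=
  affine ((((2 ^ m) ^ 3 - t : ℕ) : ℝ) / (2 ^ m) ^ r) (shiftWeight n m r)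

lemma card_numberQubits_le : (numberQubits n m).card ≤ n + 3 * 2 ^ m := by
  refine (Finset.card_union_le _ _).trans (Nat.add_le_add ?_ ?_)
  · exact Finset.card_image_le.trans (by simp)
  · exact Finset.card_image_le.trans (by simp)

lemma shiftWeight_eq_zero (r : ℕ) (q : ThresholdQubits n m) (hq : q ∉ numberQubits n m) :
    shiftWeight n m r q = 0 := by
  rcases q with i | i | p | i
  · simp [numberQubits] at hq
  · rfl
  · simp [numberQubits] at hq
  · rfl

/-- The one-hot digits below `r` contribute `-(s % M ^ r) / M ^ r`, where `M = 2 ^ m`, which turns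
`s / M ^ r` into its integer part. Digits from `r` on have weight 0, so any `k ≥ r` is allowed. -/
lemma shifted_digitState (t : ℕ) (x : Fin n → Fin 2) (z : Fin 2) {r k : ℕ} (hr : r ≤ 3)
    (hk : r ≤ k) :
    shifted n m t r (digitState x z (offsetWeight m t x) k) =
      ((offsetWeight m t x / (2 ^ m) ^ r : ℕ) : ℝ) := by
  set s := offsetWeight m t x with hs
  have hM : 0 < 2 ^ m := by positivity
  have hM' : (0 : ℝ) < 2 ^ m := by positivity
  have h1 : ∀ p : Fin 3, ∑ j : Fin (2 ^ m), (if (p : ℕ) < r then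
      -((2 ^ m : ℝ) ^ (p : ℕ) * ((j : ℕ) : ℝ)) / (2 ^ m) ^ r else 0) *
        (((if (p : ℕ) < k ∧ s / (2 ^ m) ^ (p : ℕ) % 2 ^ m = j then 1 else 0 : Fin 2) : ℕ) : ℝ) =
      -(if (p : ℕ) < r then (2 ^ m : ℝ) ^ (p : ℕ) * ((s / (2 ^ m) ^ (p : ℕ) % 2 ^ m : ℕ) : ℝ)
        else 0) / (2 ^ m) ^ r := by
    intro p
    by_cases hp : (p : ℕ) < r
    · have hpk : (p : ℕ) < k := by omega
      rw [Finset.sum_eq_single ⟨s / (2 ^ m) ^ (p : ℕ) % 2 ^ m, Nat.mod_lt _ hM⟩]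
      · simp [hp, hpk]
      · intro j _ hj
        have : ¬ s / (2 ^ m) ^ (p : ℕ) % 2 ^ m = j := fun h => hj (Fin.ext h.symm)
        simp [this]
      · simp
    · simp [hp]
  have h2 : ∑ p : Fin 3, (if (p : ℕ) < r then
      (2 ^ m) ^ (p : ℕ) * (s / (2 ^ m) ^ (p : ℕ) % 2 ^ m) else 0) = s % (2 ^ m) ^ r := by
    have e := fun k => Nat.mod_pow_succ (x := s) (b := 2 ^ m) (k := k)
    interval_cases r
    · simp [Nat.mod_one]
    · simp
    · simp [Fin.sum_univ_three, e 1]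
    · simp [Fin.sum_univ_three, e 2, e 1]
  have h3 : ((s % (2 ^ m) ^ r : ℕ) : ℝ) + (2 ^ m) ^ r * ((s / (2 ^ m) ^ r : ℕ) : ℝ) =
      (((2 ^ m) ^ 3 - t : ℕ) : ℝ) + ∑ i, ((x i : ℕ) : ℝ) := by
    rw [← Nat.cast_sum, ← Nat.cast_add, show (2 ^ m) ^ 3 - t + ∑ i, (x i : ℕ) = s from rfl]
    conv_rhs => rw [← Nat.mod_add_div s ((2 ^ m) ^ r)]
    push_cast
    ring
  simp only [shifted, affine, shiftWeight, digitState, Fintype.sum_sum_type, Sum.elim_inl,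
    Sum.elim_inr, Pi.zero_apply, zero_mul, Finset.sum_const_zero, add_zero, zero_add,
    Fintype.sum_prod_type, h1]
  rw [← Finset.mul_sum, ← Finset.sum_div, Finset.sum_neg_distrib]
  have h4 : ∑ p : Fin 3, (if (p : ℕ) < r then
      (2 ^ m : ℝ) ^ (p : ℕ) * ((s / (2 ^ m) ^ (p : ℕ) % 2 ^ m : ℕ) : ℝ) else 0) =
      ((s % (2 ^ m) ^ r : ℕ) : ℝ) := by
    rw [← h2]
    push_cast
    rfl
  rw [h4]
  field_simp
  linear_combination -h3

/-- The operator that adds the digit `r`, in unary notation, to the qubits reserved for it. -/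
noncomputable def digitStep (n m t : ℕ) (r : Fin 3) :
    Matrix (Bits (ThresholdQubits n m)) (Bits (ThresholdQubits n m)) ℂ :=
  select (testQubit n m) (digitQubit n m r) (fun j => (j : ℕ)) (shifted n m t r)

lemma digitState_add_spread (x : Fin n → Fin 2) (z : Fin 2) (s : ℕ) (r : Fin 3) :
    digitState x z s r + spread (digitQubit n m r)
      (fun j => if (2 : ℤ) ^ m ∣ ((s / (2 ^ m) ^ (r : ℕ) : ℕ) : ℤ) - (j : ℕ) then 1 else 0) =
      digitState x z s (r + 1) := by
  have hdvd : ∀ j : Fin (2 ^ m), (2 : ℤ) ^ m ∣ ((s / (2 ^ m) ^ (r : ℕ) : ℕ) : ℤ) - (j : ℕ) ↔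
      s / (2 ^ m) ^ (r : ℕ) % 2 ^ m = j := by
    intro j
    have := Nat.modEq_iff_dvd (n := 2 ^ m) (a := j) (b := s / (2 ^ m) ^ (r : ℕ))
    rw [Nat.cast_pow, Nat.cast_ofNat] at this
    rw [← this, Nat.ModEq, Nat.mod_eq_of_lt j.2, eq_comm]
  funext q
  rw [Pi.add_apply]
  rcases q with i | i | ⟨p, j⟩ | i
  · rw [spread_eq_zero _ _ (by simp [digitQubit_apply]), add_zero]
    rfl
  · rw [spread_eq_zero _ _ (by simp [digitQubit_apply]), add_zero]
    rfl
  · by_cases hp : p = r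
    · subst hp
      have := spread_apply (digitQubit n m p) (fun j =>
        if (2 : ℤ) ^ m ∣ ((s / (2 ^ m) ^ (p : ℕ) : ℕ) : ℤ) - (j : ℕ) then 1 else 0) j
      rw [digitQubit_apply] at this
      rw [this]
      simp only [hdvd]
      simp [digitState]
    · rw [spread_eq_zero _ _ (by simp [digitQubit_apply, hp]), add_zero]
      have : (p : ℕ) < r + 1 ↔ (p : ℕ) < r := by
        have : (p : ℕ) ≠ r := fun h => hp (Fin.ext h)
        omega
      simp only [digitState, Sum.elim_inr, Sum.elim_inl, this]
  · rw [spread_eq_zero _ _ (by simp [digitQubit_apply]), add_zero]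
    rfl

/-- The case `k = r` writes the digit and `k = r + 1` erases it: the same vector is added modulo 2
both times. -/
lemma digitStep_mulVec_ket (t : ℕ) (x : Fin n → Fin 2) (z : Fin 2) (r : Fin 3) {k : ℕ}
    (hk : (r : ℕ) ≤ k) :
    digitStep n m t r *ᵥ ket (digitState x z (offsetWeight m t x) k) =
      ket (digitState x z (offsetWeight m t x) k + spread (digitQubit n m r)
        (fun j => if (2 : ℤ) ^ m ∣
          ((offsetWeight m t x / (2 ^ m) ^ (r : ℕ) : ℕ) : ℤ) - (j : ℕ) then 1 else 0)) := by
  apply select_mulVec_ket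
  · simp [testQubit_apply, digitQubit_apply]
  · intro y y' h
    rw [shifted, affine, affine]
    congr 1
    apply Finset.sum_congr rfl
    rintro (i | i | ⟨p, j⟩ | i) _
    · rw [h _ (by simp [testQubit_apply]) (by simp [digitQubit_apply])]
    · simp [shiftWeight]
    · by_cases hp : p = r
      · subst hp
        simp [shiftWeight]
      · rw [h _ (by simp [testQubit_apply]) (by simp [digitQubit_apply, hp])]
    · simp [shiftWeight]
  · intro i
    rfl
  · rw [shifted_digitState t x z (by omega) hk]
    norm_cast

lemma digitStep_mulVec_ket_digitState (t : ℕ) (x : Fin n → Fin 2) (z : Fin 2) (r : Fin 3) :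
    digitStep n m t r *ᵥ ket (digitState x z (offsetWeight m t x) r) =
      ket (digitState x z (offsetWeight m t x) (r + 1)) := by
  rw [digitStep_mulVec_ket t x z r le_rfl, digitState_add_spread]

lemma digitStep_mulVec_ket_digitState_succ (t : ℕ) (x : Fin n → Fin 2) (z : Fin 2) (r : Fin 3) :
    digitStep n m t r *ᵥ ket (digitState x z (offsetWeight m t x) (r + 1)) =
      ket (digitState x z (offsetWeight m t x) r) := by
  rw [digitStep_mulVec_ket t x z r (Nat.le_succ _)]
  conv_lhs => rw [← digitState_add_spread x z (offsetWeight m t x) r]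
  rw [add_assoc, bits_add_self, add_zero]

/-- The operator that adds the highest digit to the output qubit. -/
noncomputable def outputStep (n m t : ℕ) :
    Matrix (Bits (ThresholdQubits n m)) (Bits (ThresholdQubits n m)) ℂ :=
  -- The value is 0 or 1, so the angle is 0 or `π` and no test is needed. The summand 0 matches the
  -- shape in `realizes_rotation_affine`.
  rotation (outputQubit n m) fun _ y => Real.pi * shifted n m t 3 y + 0

/-- The hypothesis `htm` keeps the natural subtraction from truncating; `1 ≤ t` and `hn` keep the
number below `2 * (2 ^ m) ^ 3`. -/
lemma offsetWeight_div {t : ℕ} (ht : 1 ≤ t) (htm : t ≤ (2 ^ m) ^ 3) (hn : n ≤ (2 ^ m) ^ 3)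
    (x : Fin n → Fin 2) :
    offsetWeight m t x / (2 ^ m) ^ 3 = if t ≤ ∑ i, (x i : ℕ) then 1 else 0 := by
  have hx : ∑ i, (x i : ℕ) ≤ n := by
    calc ∑ i, (x i : ℕ) ≤ ∑ i : Fin n, 1 := Finset.sum_le_sum fun i _ => by omega
      _ = n := by simp
  unfold offsetWeight
  split_ifs with h
  · apply Nat.div_eq_of_lt_le <;> omega
  · apply Nat.div_eq_of_lt
    omega

lemma outputStep_mulVec_ket {t : ℕ} (ht : 1 ≤ t) (htm : t ≤ (2 ^ m) ^ 3) (hn : n ≤ (2 ^ m) ^ 3)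
    (x : Fin n → Fin 2) (z : Fin 2) :
    outputStep n m t *ᵥ ket (digitState x z (offsetWeight m t x) 3) =
      ket (digitState x (z + threshold n t x) (offsetWeight m t x) 3) := by
  rw [outputStep, rotation_mulVec_ket (c := fun _ => threshold n t x)]
  · congr 1
    funext q
    rw [Pi.add_apply]
    rcases q with i | i | p | i
    · rw [spread_eq_zero _ _ (by simp [outputQubit_apply]), add_zero]
      rfl
    · have := spread_apply (outputQubit n m) (fun _ => threshold n t x) i
      rw [outputQubit_apply] at this
      rw [this]
      rfl
    · rw [spread_eq_zero _ _ (by simp [outputQubit_apply]), add_zero]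
      rfl
    · rw [spread_eq_zero _ _ (by simp [outputQubit_apply]), add_zero]
      rfl
  · intro _ y h
    congr 2
    rw [shifted, affine, affine]
    congr 1
    apply Finset.sum_congr rfl
    rintro (i | i | p | i) _
    · rw [h _ (by simp [outputQubit_apply])]
    · simp [shiftWeight]
    · rw [h _ (by simp [outputQubit_apply])]
    · simp [shiftWeight]
  · intro _
    rw [shifted_digitState t x z le_rfl le_rfl, offsetWeight_div ht htm hn, threshold]
    by_cases h : t ≤ ∑ i, (x i : ℕ) <;> simp [h]

/-- The operator of the threshold circuit. -/
noncomputable def thresholdOperator (n m t : ℕ) :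
    Matrix (Bits (ThresholdQubits n m)) (Bits (ThresholdQubits n m)) ℂ :=
  digitStep n m t 0 * (digitStep n m t 1 * (digitStep n m t 2 * (outputStep n m t *
    (digitStep n m t 2 * (digitStep n m t 1 * digitStep n m t 0)))))

lemma thresholdOperator_mulVec_ket {t : ℕ} (ht : 1 ≤ t) (htm : t ≤ (2 ^ m) ^ 3)
    (hn : n ≤ (2 ^ m) ^ 3) (x : Fin n → Fin 2) (z : Fin 2) :
    thresholdOperator n m t *ᵥ ket (digitState x z (offsetWeight m t x) 0) =
      ket (digitState x (z + threshold n t x) (offsetWeight m t x) 0) := by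
  have h1 := digitStep_mulVec_ket_digitState (m := m) t x z
  have h2 := digitStep_mulVec_ket_digitState_succ (m := m) t x (z + threshold n t x)
  simp only [thresholdOperator, ← Matrix.mulVec_mulVec]
  have a0 := h1 0
  have a1 := h1 1
  have a2 := h1 2
  have b0 := h2 0
  have b1 := h2 1
  have b2 := h2 2
  simp only [Fin.val_zero, Fin.val_one, Fin.val_two, zero_add, Nat.reduceAdd] at a0 a1 a2 b0 b1 b2
  rw [a0, a1, a2, outputStep_mulVec_ket ht htm hn, b2, b1, b0]

/-- A bound for the size of the threshold circuit. -/
def thresholdSize (n m : ℕ) : ℕ :=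
  6 * (236 * (2 ^ m * m * (1 + (n + 3 * 2 ^ m))) + 2 * 2 ^ m +
    2 ^ m * (2 ^ (m + 1) * (12 * (m + 1) + 5))) + 118 * (1 + (n + 3 * 2 ^ m))

lemma realizes_thresholdOperator (n m t : ℕ) :
    Realizes (ParityAncilla (ThresholdQubits n m)) (thresholdOperator n m t) 209
      (thresholdSize n m) := by
  have hB := card_numberQubits_le (n := n) (m := m)
  have hd : ∀ r, Realizes (ParityAncilla (ThresholdQubits n m)) (digitStep n m t r) 33
      (236 * (2 ^ m * m * (1 + (n + 3 * 2 ^ m))) + 2 * 2 ^ m +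
        2 ^ m * (2 ^ (m + 1) * (12 * (m + 1) + 5))) := by
    intro r
    obtain ⟨C, hC, hs, hm⟩ := realizes_select (a := testQubit n m) (e := digitQubit n m r)
      (by simp [testQubit_apply, digitQubit_apply]) (B := numberQubits n m)
      (by simp [numberQubits, testQubit_apply]) (c := (((2 ^ m) ^ 3 - t : ℕ) : ℝ) / (2 ^ m) ^ (r : ℕ))
      (shiftWeight_eq_zero r) (fun j => ((j : ℕ) : ℤ))
    refine ⟨C, hC, hs.trans ?_, hm⟩
    rw [Fintype.card_fin]
    gcongr
  have ho : Realizes (ParityAncilla (ThresholdQubits n m)) (outputStep n m t) 11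
      (118 * (1 + (n + 3 * 2 ^ m))) := by
    obtain ⟨C, hC, hs, hm⟩ := realizes_rotation_affine (a := outputQubit n m)
      (B := numberQubits n m) (by simp [numberQubits, outputQubit_apply])
      (c := (((2 ^ m) ^ 3 - t : ℕ) : ℝ) / (2 ^ m) ^ 3) (shiftWeight_eq_zero 3)
      (fun _ => Real.pi) (fun _ => 0)
    refine ⟨C, hC, hs.trans ?_, hm⟩
    rw [Fintype.card_fin, one_mul]
    gcongr
  -- Six digit steps of depth 33 and one output step of depth 11 give depth 209.
  obtain ⟨C, hC, hs, hm⟩ := (hd 0).mul ((hd 1).mul ((hd 2).mul (ho.mul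
    ((hd 2).mul ((hd 1).mul (hd 0))))))
  exact ⟨C, hC, hs.trans (by rw [thresholdSize]; omega), hm⟩

end Threshold

/-! ### Invariance of circuits under renaming of qubits. -/

section Relabel

variable {ι ι' : Type} [DecidableEq ι] [DecidableEq ι']

/-- The gate on relabelled qubits. -/
def Gate.map (ε : ι ≃ ι') : Gate ι → Gate ι'
  | Gate.single q U => Gate.single (ε q) U
  | Gate.fanout c T hc hT => Gate.fanout (ε c) (T.map ε.toEmbedding) (by simpa using hc)
      (by simpa using hT)

lemma Gate.support_map (ε : ι ≃ ι') (g : Gate ι) :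
    (g.map ε).support = g.support.map ε.toEmbedding := by
  cases g with
  | single q U => rfl
  | fanout c T hc hT => simp [Gate.map, Gate.support]

lemma Circuit.size_map (ε : ι ≃ ι') (C : Circuit ι) :
    Circuit.size (C.map (Gate.map ε)) = C.size := by
  have : Gate.size ∘ Gate.map ε = Gate.size := by
    funext g
    simp [Gate.size, Gate.support_map]
  rw [Circuit.size, List.map_map, this, Circuit.size]

lemma Circuit.depthFrom_map (ε : ι ≃ ι') (C : Circuit ι) (d : ι' → ℕ) (q : ι) :
    Circuit.depthFrom (C.map (Gate.map ε)) d (ε q) = Circuit.depthFrom C (d ∘ ε) q := by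
  induction C generalizing d with
  | nil => rfl
  | cons g C ih =>
    rw [List.map_cons, Circuit.depthFrom, ih, Circuit.depthFrom]
    congr 1
    funext p
    simp [Gate.support_map, Function.comp_def, Finset.sup_map]

lemma DepthLE.map (ε : ι ≃ ι') {C : Circuit ι} {k : ℕ} (h : DepthLE C k) :
    DepthLE (C.map (Gate.map ε)) k := by
  intro d b hd q
  obtain ⟨p, rfl⟩ := ε.surjective q
  rw [Circuit.depthFrom_map]
  exact h _ _ (fun p => hd (ε p)) p

variable [Fintype ι] [Fintype ι']

lemma Gate.toMatrix_map (ε : ι ≃ ι') (g : Gate ι) :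
    (g.map ε).toMatrix = g.toMatrix.submatrix (· ∘ ε) (· ∘ ε) := by
  cases g with
  | single q U =>
    ext x y
    simp only [Gate.map, Gate.toMatrix, Matrix.submatrix_apply, Matrix.of_apply, Function.comp]
    have : (∀ j, j ≠ ε q → x j = y j) ↔ ∀ j, j ≠ q → x (ε j) = y (ε j) := by
      rw [← ε.forall_congr_right]
      simp
    simp only [this]
  | fanout c T hc hT =>
    ext x y
    simp only [Gate.map, Gate.toMatrix, Matrix.submatrix_apply, Matrix.of_apply, Function.comp]
    have : (x = fun j => if j ∈ T.map ε.toEmbedding then y j + y (ε c) else y j) ↔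
        ((x ∘ ε) = fun j => if j ∈ T then y (ε j) + y (ε c) else y (ε j)) := by
      rw [funext_iff, funext_iff, ← ε.forall_congr_right]
      simp
    simp only [this]

lemma Circuit.toMatrix_map (ε : ι ≃ ι') (C : Circuit ι) :
    Circuit.toMatrix (C.map (Gate.map ε)) = (Circuit.toMatrix C).submatrix (· ∘ ε) (· ∘ ε) := by
  have hb : Function.Bijective (fun x : Bits ι' => x ∘ ε) :=
    (ε.symm.arrowCongr (Equiv.refl (Fin 2))).bijective
  induction C with
  | nil => simpa [Circuit.toMatrix] using (Matrix.submatrix_one _ hb.1).symm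
  | cons g C ih =>
    rw [List.map_cons, Circuit.toMatrix, ih, Gate.toMatrix_map, Circuit.toMatrix,
      Matrix.submatrix_mul _ _ _ _ _ hb]

lemma Circuit.map_mulVec_ket (ε : ι ≃ ι') {C : Circuit ι} {x y : Bits ι'}
    (h : C.toMatrix *ᵥ ket (x ∘ ε) = ket (y ∘ ε)) :
    Circuit.toMatrix (C.map (Gate.map ε)) *ᵥ ket x = ket y := by
  have hb : Function.Injective (fun x : Bits ι' => x ∘ ε) :=
    (ε.symm.arrowCongr (Equiv.refl (Fin 2))).injective
  funext w
  have h1 := congrFun h (w ∘ ε)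
  simp only [ket, Matrix.mulVec_single_one, Matrix.col_apply, Circuit.toMatrix_map,
    Matrix.submatrix_apply, Pi.single_apply] at h1 ⊢
  rw [h1]
  have : (w ∘ ε = y ∘ ε) ↔ w = y := hb.eq_iff
  simp only [this]

end Relabel

/-! ### The circuit on the prescribed register, and its size. -/

lemma addZeros_mulVec_ket {L K : Type} [Fintype L] [DecidableEq L] [Fintype K] [DecidableEq K]
    (x : Bits L) : addZeros L K *ᵥ ket x = ket (Sum.elim x 0) := by
  funext w
  simp [ket, addZeros, Pi.single_apply]

lemma mulVec_ket_of_mul_addZeros {L K : Type} [Fintype L] [DecidableEq L] [Fintype K]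
    [DecidableEq K] {A : Matrix (Bits (L ⊕ K)) (Bits (L ⊕ K)) ℂ} {T : Matrix (Bits L) (Bits L) ℂ}
    (h : A * addZeros L K = addZeros L K * T) {x y : Bits L} (hT : T *ᵥ ket x = ket y) :
    A *ᵥ ket (Sum.elim x 0) = ket (Sum.elim y 0) := by
  rw [← addZeros_mulVec_ket, Matrix.mulVec_mulVec, h, ← Matrix.mulVec_mulVec, hT,
    addZeros_mulVec_ket]

theorem exists_threshold_circuit {n m t : ℕ} (ht : 1 ≤ t) (htm : t ≤ (2 ^ m) ^ 3)
    (hn : n ≤ (2 ^ m) ^ 3) :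
    ∃ (a : ℕ) (C : Circuit (Register n a)),
      Computes C (threshold n t) ∧ C.depth ≤ 209 ∧ C.size ≤ thresholdSize n m := by
  obtain ⟨C, hC, hs, hm⟩ := realizes_thresholdOperator n m t
  -- Digit qubits, test qubits and parity ancillas all start and end in 0, so together they form the
  -- ancillary part of the register.
  let W := DigitQubits m ⊕ ParityAncilla (ThresholdQubits n m)
  let ε : ThresholdQubits n m ⊕ ParityAncilla (ThresholdQubits n m) ≃
      Register n (Fintype.card W) :=
    (Equiv.sumAssoc _ _ _).trans (Equiv.sumCongr (Equiv.refl _)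
      ((Equiv.sumAssoc _ _ _).trans (Equiv.sumCongr (Equiv.refl _) (Fintype.equivFin W))))
  refine ⟨_, C.map (Gate.map ε), ?_, (hC.map ε).depth_le, by rwa [Circuit.size_map]⟩
  intro x z
  apply Circuit.map_mulVec_ket
  have key : ∀ z, Register.bits (Fintype.card W) x z ∘ ε =
      Sum.elim (digitState x z (offsetWeight m t x) 0) 0 := by
    intro z
    funext q
    rcases q with (i | i | p | i) | q
    · rfl
    · rfl
    · simp [digitState, Register.bits, ε]
    · rfl
    · rfl
  rw [key, key]
  exact mulVec_ket_of_mul_addZeros hm (thresholdOperator_mulVec_ket ht htm hn x z)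

lemma sq_le_two_pow (m : ℕ) : (m + 2) ^ 2 ≤ 9 * 2 ^ m := by
  induction m with
  | zero => norm_num
  | succ m ih =>
    -- The doubling step uses `(m + 3) ^ 2 ≤ 2 * (m + 2) ^ 2`, which fails at `m = 0`.
    obtain rfl | hm := Nat.eq_zero_or_pos m
    · norm_num
    · rw [pow_succ 2]
      nlinarith

lemma thresholdSize_le {n m : ℕ} (hn : 1 ≤ n) (hm : 2 ^ m ≤ 8 * n) :
    thresholdSize n m ≤ 50000 * (n * ((m + 2) * 2 ^ m)) := by
  have h1 : 1 ≤ 2 ^ m := Nat.one_le_two_pow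
  have h2 : 1 + (n + 3 * 2 ^ m) ≤ 26 * n := by omega
  have h3 : 2 ^ m * m * (1 + (n + 3 * 2 ^ m)) ≤ 2 ^ m * m * (26 * n) := Nat.mul_le_mul_left _ h2
  have h4 : 2 ^ m * (2 ^ (m + 1) * (12 * (m + 1) + 5)) ≤
      2 ^ m * (2 * (8 * n) * (12 * (m + 1) + 5)) := by
    rw [pow_succ' 2 m]
    gcongr
  have h5 : 2 ^ m ≤ n * 2 ^ m := Nat.le_mul_of_pos_left _ hn
  have h6 : n ≤ n * 2 ^ m := Nat.le_mul_of_pos_right _ h1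
  have e3 : 2 ^ m * m * (26 * n) = 26 * (n * 2 ^ m * m) := by ring
  have e4 : 2 ^ m * (2 * (8 * n) * (12 * (m + 1) + 5)) =
      192 * (n * 2 ^ m * m) + 272 * (n * 2 ^ m) := by ring
  have e5 : n * ((m + 2) * 2 ^ m) = n * 2 ^ m * m + 2 * (n * 2 ^ m) := by ring
  rw [thresholdSize, e5]
  omega

lemma thresholdSize_clog_le {n : ℕ} (hn : 2 ≤ n) :
    (thresholdSize n (Nat.clog 8 n) : ℝ) ≤
      450000 * ((n : ℝ) * √((n : ℝ) * Real.logb 2 (n : ℝ))) := by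
  set m := Nat.clog 8 n with hm
  have h8 : (2 ^ m) ^ 3 ≤ 8 * n := by
    have h1 : 8 ^ (m - 1) < n := Nat.pow_pred_clog_lt_self (by norm_num) (by omega)
    have h2 : 0 < m := Nat.clog_pos (by norm_num) hn
    rw [← pow_mul, mul_comm m 3, pow_mul]
    calc (2 ^ 3) ^ m = 8 * 8 ^ (m - 1) := by
          rw [← pow_succ', Nat.sub_add_cancel h2]
          norm_num
      _ ≤ 8 * n := by omega
  have h2m : 2 ^ m ≤ 8 * n := le_trans (Nat.le_self_pow (by norm_num) _) h8
  -- One spare factor `2 ^ m` absorbs `(m + 2) ^ 2`, since `(2 ^ m) ^ 2` is only of order `n ^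
  -- (2/3)`.
  have hsq : ((m + 2) * 2 ^ m) ^ 2 ≤ 72 * n := by
    calc ((m + 2) * 2 ^ m) ^ 2 = (m + 2) ^ 2 * (2 ^ m) ^ 2 := by ring
      _ ≤ 9 * 2 ^ m * (2 ^ m) ^ 2 := Nat.mul_le_mul_right _ (sq_le_two_pow m)
      _ = 9 * (2 ^ m) ^ 3 := by ring
      _ ≤ 72 * n := by omega
  have hlog : 1 ≤ Real.logb 2 (n : ℝ) := by
    rw [Real.le_logb_iff_rpow_le (by norm_num) (by positivity), Real.rpow_one]
    exact_mod_cast hn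
  have hsqrt : (((m + 2) * 2 ^ m : ℕ) : ℝ) ≤ 9 * √((n : ℝ) * Real.logb 2 (n : ℝ)) := by
    have h1 : (((m + 2) * 2 ^ m : ℕ) : ℝ) ^ 2 ≤ 72 * n := by exact_mod_cast hsq
    have hn0 : (0 : ℝ) < n := by positivity
    have h2 : (n : ℝ) ≤ n * Real.logb 2 (n : ℝ) := le_mul_of_one_le_right hn0.le hlog
    refine (sq_le_sq₀ (by positivity) (by positivity)).1 ?_
    rw [mul_pow, Real.sq_sqrt (by positivity)]
    linarith
  have h1 : (thresholdSize n m : ℝ) ≤ 50000 * (n * (((m + 2) * 2 ^ m : ℕ) : ℝ)) := by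
    exact_mod_cast thresholdSize_le (by omega) h2m
  have h2 := mul_le_mul_of_nonneg_left hsqrt (Nat.cast_nonneg (α := ℝ) n)
  linarith

end ExactQC

theorem corollary2 :
    ∃ (D : ℕ) (a : ℕ → ℕ)
      (C : (n : ℕ) → ExactQC.Circuit (ExactQC.Register n (a n))),
      (∀ n : ℕ, 1 ≤ n →
        ExactQC.Computes (C n) (ExactQC.threshold n ⌈(n : ℝ) / 2⌉₊) ∧
        (C n).depth ≤ D) ∧
      (fun n : ℕ => ((C n).size : ℝ)) =O[Filter.atTop]
        (fun n : ℕ => (n : ℝ) * √((n : ℝ) * Real.logb 2 (n : ℝ))) := by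
  have h : ∀ n : ℕ, ∃ (a : ℕ) (C : ExactQC.Circuit (ExactQC.Register n a)), 1 ≤ n →
      ExactQC.Computes C (ExactQC.threshold n ⌈(n : ℝ) / 2⌉₊) ∧ C.depth ≤ 209 ∧
        C.size ≤ ExactQC.thresholdSize n (Nat.clog 8 n) := by
    intro n
    by_cases hn : 1 ≤ n
    · have hpow : n ≤ (2 ^ Nat.clog 8 n) ^ 3 := by
        rw [← pow_mul, mul_comm, pow_mul]
        exact Nat.le_pow_clog (by norm_num) n
      have h1 : 1 ≤ ⌈(n : ℝ) / 2⌉₊ := Nat.one_le_iff_ne_zero.2 (by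
        have : (0 : ℝ) < n := by exact_mod_cast hn
        exact (Nat.ceil_pos.2 (by positivity)).ne')
      have h2 : ⌈(n : ℝ) / 2⌉₊ ≤ n := Nat.ceil_le.2 (half_le_self (Nat.cast_nonneg n))
      obtain ⟨a, C, hC⟩ := ExactQC.exists_threshold_circuit h1 (h2.trans hpow) hpow
      exact ⟨a, C, fun _ => hC⟩
    · exact ⟨0, [], fun h => absurd h hn⟩
  choose a C hC using h
  refine ⟨209, a, C, fun n hn => ⟨(hC n hn).1, (hC n hn).2.1⟩, ?_⟩
  refine Asymptotics.IsBigO.of_bound 450000 ?_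
  -- At `n = 1` the logarithm, and with it the bound, vanishes.
  filter_upwards [Filter.eventually_ge_atTop 2] with n hn
  rw [Real.norm_of_nonneg (Nat.cast_nonneg _), Real.norm_of_nonneg (by positivity)]
  exact (Nat.cast_le.2 (hC n (by omega)).2.2).trans (ExactQC.thresholdSize_clog_le hn)
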